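/- Let $a\in C^{2,1}(\mathbb{R}\times\mathbb{R}^+)$ and $b\in C^{3,1}(\mathbb{R}\times\mathbb{R}^+)$, where $\mathbb{R}^+=[0,\infty)$ and $f\in C^{k,1}$ means that the derivatives of $f(x,t)$ in $x$ up to order $k$ and its first derivative in $t$ exist and are continuous. Let $T>0$, $S_0\in\mathbb{R}$, and let $W$ be a standard Brownian motion. Put $L_0=\partial/\partial t+a\,\partial/\partial x$, $L_1=b\,\partial/\partial x$, $b'=\partial b/\partial x$. Assume that there are constants $K_1,K_2,K_3$ such that for all $x,y\in\mathbb{R}$ and $s,t\in[0,T]$ $$|a(x,t)-a(y,t)|+|b(x,t)-b(y,t)|+|L_1b(x,t)-L_1b(y,t)|\le K_1|x-y|,$$ $$|a|+|L_0a|+|L_1a|+|b|+|L_0b|+|L_1b|+|L_0L_1b|+|L_1L_1b|\le K_2(1+|x|)\quad\text{at }(x,t),$$ $$|b(x,t)-b(x,s)|\le K_3(1+|x|)\sqrt{|t-s|},$$ where the existence of the time derivative of $L_1b$ on $\mathbb{R}\times[0,T]$ is part of the second condition. For a positive integer $N$ let $h=T/N$, $t_n=nh$, $W_n=W(t_n)$,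 and define the Milstein values by $\widehat S_0=S_0$ and $$\widehat S_{n+1}=\widehat S_n+a_nh+b_n(W_{n+1}-W_n)+\tfrac12 b_n'b_n\big((W_{n+1}-W_n)^2-h\big),$$ where $a_n,b_n,b_n'$ are evaluated at $(\widehat S_n,t_n)$. For $t_n\le t\le t_{n+1}$ put $\lambda=(t-t_n)/h$ and define the Kloeden–Platen and the Brownian-bridge interpolants by $$\widehat S_{KP}(t)=\widehat S_n+a_n(t-t_n)+b_n(W(t)-W_n)+\tfrac12 b_n'b_n\big((W(t)-W_n)^2-(t-t_n)\big),$$ $$\widehat S(t)=\widehat S_n+\lambda(\widehat S_{n+1}-\widehat S_n)+b_n\big(W(t)-W_n-\lambda(W_{n+1}-W_n)\big).$$ Then, as $h\to0$ (that is, $N\to\infty$), for every positive integer $m$: (i) $\displaystyle\mathbb{E}\Big[\sup_{t\in[0,T]}|\widehat S(t)-\widehat S_{KP}(t)|^m\Big]=O\big(|h\log h|^m\big)$; (ii) $\displaystyle\sup_{t\in[0,T]}\mathbb{E}\big[|\widehat S(t)-\widehat S_{KP}(t)|^m\big]=O(h^m)$; and, moreover, (iii) for every $N\geq 1$, almost every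 path of $\widehat S-\widehat S_{KP}$ is integrable on $[0,T]$, and $\displaystyle\mathbb{E}\Big[\Big(\int_0^T(\widehat S(t)-\widehat S_{KP}(t))\,dt\Big)^2\Big]=O(h^3)$. -/

import Mathlib

open MeasureTheory ProbabilityTheory Filter Set
open scoped NNReal ENNReal

namespace MilsteinMLMC

noncomputable section

/-- The partial derivative `∂f/∂S` of a function `f (S, t)`. -/
def dS (f : ℝ → ℝ → ℝ) (x t : ℝ) : ℝ := deriv (fun y => f y t) x

/-- The partial derivative `∂f/∂t` of a function `f (S, t)` on `ℝ × [0, ∞)`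
(one-sided at `t = 0`). -/
def dt (f : ℝ → ℝ → ℝ) (x t : ℝ) : ℝ := derivWithin (fun s => f x s) (Ici 0) t

/-- The operator `L₀ = ∂/∂t + a ∂/∂S`. -/
def L0 (a f : ℝ → ℝ → ℝ) (x t : ℝ) : ℝ := dt f x t + a x t * dS f x t

/-- The operator `L₁ = b ∂/∂S`. -/
def L1 (b f : ℝ → ℝ → ℝ) (x t : ℝ) : ℝ := b x t * dS f x t

/-- The class `C^{k,1}(ℝ × ℝ⁺)`: the derivatives in `S` up to order `k` and the first derivative
in `t` exist and are continuous on `ℝ × [0, ∞)`. -/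
structure IsCk1 (k : ℕ) (f : ℝ → ℝ → ℝ) : Prop where
  contDiff_space : ∀ t, 0 ≤ t → ContDiff ℝ k (fun x => f x t)
  continuousOn_space : ∀ j ≤ k,
    ContinuousOn (fun p : ℝ × ℝ => iteratedDeriv j (fun x => f x p.2) p.1) (univ ×ˢ Ici 0)
  differentiableOn_time : ∀ x, DifferentiableOn ℝ (fun t => f x t) (Ici 0)
  continuousOn_time : ContinuousOn (fun p : ℝ × ℝ => dt f p.1 p.2) (univ ×ˢ Ici 0)

/-- Uniform Lipschitz condition on `[0, T]`. -/
def UniformLipschitz (a b : ℝ → ℝ → ℝ) (T : ℝ) : Prop :=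
  ∃ K : ℝ, ∀ x y : ℝ, ∀ t ∈ Icc 0 T,
    |a x t - a y t| + |b x t - b y t| + |L1 b b x t - L1 b b y t| ≤ K * |x - y|

/-- Linear growth bound on `[0, T]`. The first conjunct says that the time derivative of `L₁ b`,
which occurs in `L₀ L₁ b`, exists. -/
def LinearGrowth (a b : ℝ → ℝ → ℝ) (T : ℝ) : Prop :=
  (∀ x : ℝ, ∀ t ∈ Icc 0 T, DifferentiableWithinAt ℝ (fun s => L1 b b x s) (Ici 0) t) ∧
  ∃ K : ℝ, ∀ x : ℝ, ∀ t ∈ Icc 0 T,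
    |a x t| + |L0 a a x t| + |L1 b a x t| + |b x t| + |L0 a b x t|
      + |L1 b b x t| + |L0 a (L1 b b) x t| + |L1 b (L1 b b) x t| ≤ K * (1 + |x|)

/-- Additional Lipschitz condition (Hölder continuity of order `1/2` in time) on `[0, T]`. -/
def TimeHolder (b : ℝ → ℝ → ℝ) (T : ℝ) : Prop :=
  ∃ K : ℝ, ∀ x : ℝ, ∀ s ∈ Icc 0 T, ∀ t ∈ Icc 0 T,
    |b x t - b x s| ≤ K * (1 + |x|) * √|t - s|

/-- The standing assumptions on the drift `a` and the volatility `b`. -/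
structure Assumptions (a b : ℝ → ℝ → ℝ) (T : ℝ) : Prop where
  drift_smooth : IsCk1 2 a
  vol_smooth : IsCk1 3 b
  lipschitz : UniformLipschitz a b T
  growth : LinearGrowth a b T
  holder : TimeHolder b T

/-- The Milstein values `Ŝ_n` along the driving path `w`, with timestep `h`, `t_n = n h`. -/
def milstein (a b : ℝ → ℝ → ℝ) (S₀ h : ℝ) (w : ℝ → ℝ) : ℕ → ℝ
  | 0 => S₀
  | n + 1 =>
    let s := milstein a b S₀ h w n
    let t := n * h
    let ΔW := w ((n + 1) * h) - w t
    s + a s t * h + b s t * ΔW + 1 / 2 * dS b s t * b s t * (ΔW ^ 2 - h)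

/-- The Kloeden–Platen interpolant. The index is `n = ⌊t / h⌋`, so `t_n ≤ t < t_{n+1}`; at
`t = t_n` the formula gives `Ŝ_n`, as does the one of the preceding interval. -/
def kpInterpolant (a b : ℝ → ℝ → ℝ) (S₀ h : ℝ) (w : ℝ → ℝ) (t : ℝ) : ℝ :=
  let n := ⌊t / h⌋₊
  let s := milstein a b S₀ h w n
  let tn := n * h
  s + a s tn * (t - tn) + b s tn * (w t - w tn)
    + 1 / 2 * dS b s tn * b s tn * ((w t - w tn) ^ 2 - (t - tn))

/-- The Brownian-bridge interpolant, with the same convention for the index `n`. -/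
def bridgeInterpolant (a b : ℝ → ℝ → ℝ) (S₀ h : ℝ) (w : ℝ → ℝ) (t : ℝ) : ℝ :=
  let n := ⌊t / h⌋₊
  let s := milstein a b S₀ h w n
  let tn := n * h
  let tn' := (n + 1) * h
  let lam := (t - tn) / h
  s + lam * (milstein a b S₀ h w (n + 1) - s)
    + b s tn * (w t - w tn - lam * (w tn' - w tn))

/-- The difference `Ŝ(t) - Ŝ_KP(t)` for the process `W` and `N` uniform timesteps on `[0, T]`,
that is, for `h = T / N`. -/
def interpolantDiff {Ω : Type*} (a b : ℝ → ℝ → ℝ) (S₀ T : ℝ) (W : ℝ≥0 → Ω → ℝ) (N : ℕ)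
    (t : ℝ) (ω : Ω) : ℝ :=
  bridgeInterpolant a b S₀ (T / N) (fun r => W r.toNNReal ω) t
    - kpInterpolant a b S₀ (T / N) (fun r => W r.toNNReal ω) t

end

end MilsteinMLMC

/-! On a cell the drift terms and the terms linear in `W` cancel in the difference. What is left is
½ b'_n b_n (λ (W_{n+1} - W_n)² - (W(t) - W_n)²): a coefficient known at t_n, of linear growth in the
Milstein value, times a quadratic form of size h in later increments.

For (ii), Young's inequality with weight h separates the two factors. The Milstein values have
moments bounded uniformly in h (`milstein_moment_le`), since the part of order √h of a step is
centred and one step changes the conditional expectation of (1 + x²)^q only by a relative O(h)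
(`milstein_step_moment`). Gaussian scaling handles the increments.

For (i), the maximum of the Milstein values is controlled by a Doob-type inequality: up to a factor
(1 - Ch)^(-n/2), the moment function has a submartingale as its square (`milstein_max_moment_le`).
The squared Brownian oscillation on a cell, divided by h, has an exponential moment
(`exists_measurable_iSup_exp_sq_le`), so the maximum over all cells costs only a factor log N.

For (iii), the quadratic form has conditional mean λh - (t - t_n) = 0, so differences at times in
distinct cells are orthogonal (`integral_cellDiff_mul_cellDiff`). In the double time integral of the
covariance only diagonal cells, of total area Th, survive; there the integrand is O(h²) by (ii). -/

namespace MilsteinMLMC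

/-! ### Regular versions of the path, and independence of the past -/

theorem exists_continuous_measurable_modification {Ω : Type*} [MeasurableSpace Ω] {P : Measure Ω}
    {W : ℝ≥0 → Ω → ℝ} (hm : ∀ t, AEMeasurable (W t) P) (hc : ∀ᵐ ω ∂P, Continuous (W · ω)) :
    ∃ B : ℝ≥0 → Ω → ℝ, (∀ t, Measurable (B t)) ∧ (∀ ω, Continuous (B · ω)) ∧
      ∀ᵐ ω ∂P, ∀ t, W t ω = B t ω := by
  classical
  obtain ⟨D, hDc, hDd⟩ := TopologicalSpace.exists_countable_dense ℝ≥0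
  have hae : ∀ᵐ ω ∂P, Continuous (W · ω) ∧ ∀ q ∈ D, W q ω = (hm q).mk (W q) ω := by
    refine hc.and ((ae_ball_iff hDc).2 fun q _ => (hm q).ae_eq_mk)
  -- Outside the measurable null set `s` the path is continuous and agrees on `D` with measurable
  -- representatives. The version vanishes on `s`; at any other time it is a limit along `D`, hence
  -- measurable.
  obtain ⟨s, hs, hsm, hs0⟩ := exists_measurable_superset_of_null (ae_iff.1 hae)
  have hgood : ∀ ω, ω ∉ s → Continuous (W · ω) ∧ ∀ q ∈ D, W q ω = (hm q).mk (W q) ω := by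
    intro ω hω
    by_contra h
    exact hω (hs h)
  refine ⟨fun t ω => if ω ∈ s then 0 else W t ω, fun t => ?_, fun ω => ?_, ?_⟩
  · obtain ⟨u, hu, hut⟩ := mem_closure_iff_seq_limit.1 (hDd t)
    refine measurable_of_tendsto_metrizable
      (f := fun n ω => if ω ∈ s then 0 else (hm (u n)).mk (W (u n)) ω) (fun n => ?_) ?_
    · exact Measurable.ite hsm measurable_const (hm (u n)).measurable_mk
    · rw [tendsto_pi_nhds]
      intro ω
      by_cases hω : ω ∈ s
      · simp [hω]
      · simp only [hω, if_false]
        have h := ((hgood ω hω).1.tendsto t).comp hut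
        refine h.congr fun n => ?_
        exact (hgood ω hω).2 _ (hu n)
  · by_cases hω : ω ∈ s
    · simpa [hω] using continuous_const
    · simpa [hω] using (hgood ω hω).1
  · have : ∀ᵐ ω ∂P, ω ∉ s := measure_eq_zero_iff_ae_notMem.1 hs0
    filter_upwards [this] with ω hω t
    simp [hω]

/-- The σ-algebra generated by a process up to time `t₀`. -/
@[reducible]
def past {Ω : Type*} (W : ℝ≥0 → Ω → ℝ) (t₀ : ℝ≥0) : MeasurableSpace Ω :=
  MeasurableSpace.comap (fun ω (t : Set.Iic t₀) => W t ω) inferInstance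

section

variable {Ω : Type*} [mΩ : MeasurableSpace Ω] {P : Measure Ω} {W : ℝ≥0 → Ω → ℝ}

theorem measurable_past {Ω : Type*} {W : ℝ≥0 → Ω → ℝ} {t₀ t : ℝ≥0} (h : t ≤ t₀) : Measurable[past W t₀] (W t) :=
  (measurable_pi_apply (⟨t, h⟩ : Set.Iic t₀)).comp
    (comap_measurable (fun ω (t : Set.Iic t₀) => W t ω))

theorem past_le (hm : ∀ t, Measurable (W t)) (t₀ : ℝ≥0) : past W t₀ ≤ mΩ :=
  (measurable_pi_lambda _ fun t : Set.Iic t₀ => hm t).comap_le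

/-- `Ψ` may depend on the whole future increment process, because the orthogonality of cells
involves two increments at once. -/
theorem indepFun_past (hW : IsPreBrownianReal W P) {t₀ : ℝ≥0} {β γ : Type*}
    [MeasurableSpace β] [MeasurableSpace γ] {X : Ω → β} (hX : Measurable[past W t₀] X)
    {Ψ : (ℝ≥0 → ℝ) → γ} (hΨ : Measurable Ψ) :
    IndepFun X (fun ω => Ψ fun t => W (t₀ + t) ω - W t₀ ω) P := by
  have h := (hW.indepFun_shift t₀).symm
  rw [IndepFun_iff_Indep] at h ⊢
  refine indep_of_indep_of_le_left (indep_of_indep_of_le_right h ?_) ?_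
  · rw [← measurable_iff_comap_le]
    exact hΨ.comp (comap_measurable _)
  · exact hX.comap_le

theorem indepFun_past_increment (hW : IsPreBrownianReal W P) {t₀ : ℝ≥0} (u : ℝ≥0) {β : Type*}
    [MeasurableSpace β] {X : Ω → β} (hX : Measurable[past W t₀] X) :
    IndepFun X (fun ω => W (t₀ + u) ω - W t₀ ω) P :=
  indepFun_past hW hX (Ψ := fun f => f u) (by fun_prop)

/-- The joint law of `X` and the increment is a product, so Tonelli allows `X` to be frozen. This
stands in for conditional expectation and, `f` being nonnegative, needs no integrability. -/
theorem lintegral_past_increment [IsProbabilityMeasure P] (hW : IsPreBrownianReal W P)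
    (hm : ∀ t, Measurable (W t)) {t₀ : ℝ≥0} (u : ℝ≥0) {β : Type*}
    [MeasurableSpace β] {X : Ω → β} (hX : Measurable[past W t₀] X) {f : β → ℝ → ℝ≥0∞}
    (hf : Measurable (Function.uncurry f)) :
    ∫⁻ ω, f (X ω) (W (t₀ + u) ω - W t₀ ω) ∂P
      = ∫⁻ ω, ∫⁻ g, f (X ω) g ∂(gaussianReal 0 u) ∂P := by
  have hX' : Measurable X := hX.mono (past_le hm t₀) le_rfl
  have hξ : Measurable fun ω => W (t₀ + u) ω - W t₀ ω := (hm _).sub (hm _)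
  have hi := indepFun_past_increment hW u hX
  rw [indepFun_iff_map_prod_eq_prod_map_map hX'.aemeasurable hξ.aemeasurable] at hi
  have hl : P.map (fun ω => W (t₀ + u) ω - W t₀ ω) = gaussianReal 0 u :=
    ((hW.shift t₀).hasLaw_eval u).map_eq
  rw [hl] at hi
  have : IsProbabilityMeasure (P.map X) := Measure.isProbabilityMeasure_map hX'.aemeasurable
  calc ∫⁻ ω, f (X ω) (W (t₀ + u) ω - W t₀ ω) ∂P
      = ∫⁻ p, Function.uncurry f p ∂(P.map fun ω => (X ω, W (t₀ + u) ω - W t₀ ω)) := by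
        rw [lintegral_map hf (hX'.prodMk hξ)]; rfl
    _ = ∫⁻ x, ∫⁻ g, f x g ∂(gaussianReal 0 u) ∂(P.map X) := by
        rw [hi, lintegral_prod _ hf.aemeasurable]; rfl
    _ = _ := by
        exact lintegral_map (f := fun x => ∫⁻ g, f x g ∂(gaussianReal 0 u))
          hf.lintegral_prod_right' hX'

end

/-! ### Maximal inequalities -/

section

variable {Ω : Type*} [MeasurableSpace Ω] {P : Measure Ω}

/-- Weak type maximal inequality for nonnegative processes that are submartingales along the
events that a fixed level has been exceeded. -/
theorem mul_measure_exists_le_lintegral {Y : ℕ → Ω → ℝ≥0∞} (hY : ∀ n, Measurable (Y n)) (N : ℕ)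
    (c : ℝ≥0∞) (h : ∀ n < N, ∫⁻ ω in {ω | ∃ k ≤ n, c ≤ Y k ω}, Y n ω ∂P
      ≤ ∫⁻ ω in {ω | ∃ k ≤ n, c ≤ Y k ω}, Y (n + 1) ω ∂P) :
    c * P {ω | ∃ k ≤ N, c ≤ Y k ω} ≤ ∫⁻ ω, Y N ω ∂P := by
  have hA : ∀ n, MeasurableSet {ω | ∃ k ≤ n, c ≤ Y k ω} := fun n => by
    have : {ω | ∃ k ≤ n, c ≤ Y k ω} = ⋃ k ∈ Finset.range (n + 1), {ω | c ≤ Y k ω} := by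
      ext; simp
    rw [this]
    exact Finset.measurableSet_biUnion _ fun k _ => measurableSet_le measurable_const (hY k)
  have key : ∀ n ≤ N, c * P {ω | ∃ k ≤ n, c ≤ Y k ω}
      ≤ ∫⁻ ω in {ω | ∃ k ≤ n, c ≤ Y k ω}, Y n ω ∂P := by
    intro n
    induction n with
    | zero =>
      intro _
      rw [← setLIntegral_const]
      refine setLIntegral_mono (hY 0) fun ω hω => ?_
      obtain ⟨k, hk, hc⟩ := hω
      obtain rfl : k = 0 := by omega
      exact hc
    | succ n ih =>
      intro hn
      -- Split by first passage: on `A` the level was reached before and the hypothesis carries the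
      -- bound over; on `R` it is reached now, so `c` is below the current value.
      set A := {ω | ∃ k ≤ n, c ≤ Y k ω} with hAdef
      set R := {ω | c ≤ Y (n + 1) ω} \ A with hRdef
      have hR : MeasurableSet R := (measurableSet_le measurable_const (hY _)).diff (hA n)
      have hU : {ω | ∃ k ≤ n + 1, c ≤ Y k ω} = A ∪ R := by
        ext ω
        simp only [hRdef, union_sdiff_self, mem_union, hAdef, mem_ofPred_eq]
        constructor
        · rintro ⟨k, hk, hc⟩
          rcases Nat.lt_or_ge n k with h' | h'
          · obtain rfl : k = n + 1 := by omega
            exact Or.inr hc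
          · exact Or.inl ⟨k, h', hc⟩
        · rintro (⟨k, hk, hc⟩ | hc)
          · exact ⟨k, by omega, hc⟩
          · exact ⟨n + 1, le_rfl, hc⟩
      have hd : Disjoint A R := disjoint_sdiff_self_right
      rw [hU, measure_union hd hR, lintegral_union hR hd, mul_add]
      gcongr
      · exact (ih (by omega)).trans (h n (by omega))
      · rw [← setLIntegral_const]
        exact setLIntegral_mono (hY _) fun ω hω => hω.1
  exact (key N le_rfl).trans (setLIntegral_le_lintegral _ _)

/-- A finite z > 1 lies in some [2^j, 2^(j+1)), and the j-th term alone dominates it. This is a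
discrete layer-cake formula. -/
theorem le_one_add_tsum_dyadic (z : ℝ≥0∞) :
    z ≤ 1 + ∑' j : ℕ, if 2 ^ j ≤ z then (2 : ℝ≥0∞) ^ (j + 1) else 0 := by
  classical
  by_cases hz : z = ∞
  · subst hz
    have : ∑' j : ℕ, (if (2 : ℝ≥0∞) ^ j ≤ ∞ then (2 : ℝ≥0∞) ^ (j + 1) else 0) = ∞ := by
      refine top_le_iff.1 ?_
      refine (ENNReal.tsum_const_eq_top_of_ne_zero (α := ℕ) (c := 1) one_ne_zero).ge.trans
        (ENNReal.tsum_le_tsum fun j => ?_)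
      rw [if_pos le_top]
      exact one_le_pow₀ (by norm_num)
    rw [this]; simp
  rcases le_or_gt z 1 with h1 | h1
  · exact h1.trans le_self_add
  have hex : ∃ j : ℕ, z < 2 ^ j := by
    lift z to ℝ≥0 using hz
    obtain ⟨j, hj⟩ := pow_unbounded_of_one_lt z (by norm_num : (1 : ℝ≥0) < 2)
    exact ⟨j, by exact_mod_cast hj⟩
  obtain ⟨j, hj, hmin⟩ : ∃ j : ℕ, z < 2 ^ (j + 1) ∧ 2 ^ j ≤ z := by
    have hs := Nat.find_spec hex
    have hm := fun k => Nat.find_min hex (m := k)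
    rcases hk : Nat.find hex with _ | j
    · rw [hk] at hs; exact absurd h1 (not_lt.2 (by simpa using hs.le))
    · rw [hk] at hs hm
      exact ⟨j, hs, not_lt.1 (hm j (Nat.lt_succ_self j))⟩
  calc z ≤ 2 ^ (j + 1) := hj.le
    _ = if 2 ^ j ≤ z then (2 : ℝ≥0∞) ^ (j + 1) else 0 := by simp [hmin]
    _ ≤ ∑' j : ℕ, if 2 ^ j ≤ z then (2 : ℝ≥0∞) ^ (j + 1) else 0 := ENNReal.le_tsum j
    _ ≤ _ := le_add_self

/-- The dyadic level 2^j contributes at most 2^(j+1) · C · 4^(-j) = 2C · 2^(-j), which sums to 4C.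
-/
theorem lintegral_le_of_sq_mul_measure_le [IsProbabilityMeasure P] {Z : Ω → ℝ≥0∞}
    (hZ : Measurable Z) {C : ℝ≥0∞} (h : ∀ c : ℝ≥0∞, c ^ 2 * P {ω | c ≤ Z ω} ≤ C) :
    ∫⁻ ω, Z ω ∂P ≤ 1 + 4 * C := by
  have hms : ∀ j : ℕ, MeasurableSet {ω | (2 : ℝ≥0∞) ^ j ≤ Z ω} := fun j =>
    measurableSet_le measurable_const hZ
  calc ∫⁻ ω, Z ω ∂P
      ≤ ∫⁻ ω, (1 + ∑' j : ℕ, {ω | (2 : ℝ≥0∞) ^ j ≤ Z ω}.indicator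
          (fun _ => (2 : ℝ≥0∞) ^ (j + 1)) ω) ∂P :=
        lintegral_mono fun ω => by
          simpa only [Set.indicator, mem_ofPred_eq] using le_one_add_tsum_dyadic (Z ω)
    _ = 1 + ∑' j : ℕ, 2 ^ (j + 1) * P {ω | (2 : ℝ≥0∞) ^ j ≤ Z ω} := by
        rw [lintegral_add_left measurable_const, lintegral_tsum fun j =>
          (measurable_const.indicator (hms j)).aemeasurable]
        simp_rw [lintegral_indicator_const (hms _)]
        simp
    _ ≤ 1 + ∑' j : ℕ, 2 * C * (2⁻¹) ^ j := by
        refine add_le_add le_rfl (ENNReal.tsum_le_tsum fun j => ?_)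
        have h2 : (2 : ℝ≥0∞) ^ j * (2⁻¹) ^ j = 1 := by
          rw [← mul_pow, ENNReal.mul_inv_cancel (by norm_num) (by norm_num), one_pow]
        calc (2 : ℝ≥0∞) ^ (j + 1) * P {ω | (2 : ℝ≥0∞) ^ j ≤ Z ω}
            = 2 * (((2 : ℝ≥0∞) ^ j) ^ 2 * P {ω | (2 : ℝ≥0∞) ^ j ≤ Z ω}) * (2⁻¹) ^ j := by
              rw [pow_succ]
              calc _ = 2 * (2 ^ j * P {ω | (2 : ℝ≥0∞) ^ j ≤ Z ω}) * 1 := by ring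
                _ = _ := by rw [← h2]; ring
          _ ≤ _ := by gcongr; exact h _
    _ = 1 + 4 * C := by
        rw [ENNReal.tsum_mul_left, ENNReal.tsum_geometric]
        have : (1 - 2⁻¹ : ℝ≥0∞)⁻¹ = 2 := by
          rw [ENNReal.one_sub_inv_two, inv_inv]
        rw [this]; ring

/-- A maximal inequality: if `U²` is a submartingale along level events, then the expected maximum
of `U` is controlled by the second moment of the last value. -/
theorem lintegral_iSup_le_of_sq_submartingale [IsProbabilityMeasure P] {U : ℕ → Ω → ℝ≥0∞}
    (hU : ∀ n, Measurable (U n)) (N : ℕ)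
    (h : ∀ c : ℝ≥0∞, ∀ n < N, ∫⁻ ω in {ω | ∃ k ≤ n, c ≤ U k ω}, U n ω ^ 2 ∂P
      ≤ ∫⁻ ω in {ω | ∃ k ≤ n, c ≤ U k ω}, U (n + 1) ω ^ 2 ∂P) :
    ∫⁻ ω, ⨆ k ∈ Finset.range (N + 1), U k ω ∂P ≤ 1 + 4 * ∫⁻ ω, U N ω ^ 2 ∂P := by
  refine lintegral_le_of_sq_mul_measure_le
    (Measurable.iSup fun k => Measurable.iSup fun _ => hU k) fun c => ?_
  have hsq : ∀ x : ℝ≥0∞, c ^ 2 ≤ x ^ 2 ↔ c ≤ x := fun x => by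
    exact ENNReal.pow_le_pow_left_iff two_ne_zero
  -- The strict bound on a finite supremum below needs c > 0, since the empty supremum is 0.
  rcases eq_or_ne c 0 with rfl | hc
  · simp
  have hset : {ω | c ≤ ⨆ k ∈ Finset.range (N + 1), U k ω} = {ω | ∃ k ≤ N, c ^ 2 ≤ U k ω ^ 2} := by
    ext ω
    simp only [mem_ofPred_eq, hsq]
    constructor
    · intro hle
      by_contra! hcon
      refine absurd hle (not_le.2 ?_)
      rw [← Finset.sup_eq_iSup, Finset.sup_lt_iff (by simpa using pos_iff_ne_zero.2 hc)]
      intro k hk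
      exact hcon k (by simpa [Nat.lt_succ_iff] using hk)
    · rintro ⟨k, hk, hle⟩
      exact hle.trans (le_iSup₂_of_le k (by simpa [Nat.lt_succ_iff] using hk) le_rfl)
  rw [hset]
  refine mul_measure_exists_le_lintegral (Y := fun n ω => U n ω ^ 2)
    (fun n => (hU n).pow_const 2) N (c ^ 2) fun n hn => ?_
  simpa only [hsq] using h c n hn

end

/-! ### Gaussian integrals and the effect of one Milstein step -/

theorem integrable_pow_gaussian (v : ℝ≥0) (n : ℕ) :
    Integrable (fun z : ℝ => z ^ n) (gaussianReal 0 v) := by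
  have h : MemLp (fun z : ℝ => z) n (gaussianReal 0 v) := by
    exact_mod_cast memLp_id_gaussianReal (μ := 0) (v := v) (n : ℝ≥0)
  have h2 := h.integrable_norm_pow'
  refine h2.mono' (by fun_prop) (ae_of_all _ fun z => by simp)

theorem integrable_one_add_sq_pow_gaussian (v : ℝ≥0) (n : ℕ) :
    Integrable (fun z : ℝ => (1 + z ^ 2) ^ n) (gaussianReal 0 v) := by
  have : (fun z : ℝ => (1 + z ^ 2) ^ n)
      = fun z => ∑ k ∈ Finset.range (n + 1), z ^ (2 * (n - k)) * (n.choose k : ℝ) := by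
    funext z
    rw [add_pow]
    refine Finset.sum_congr rfl fun k _ => ?_
    rw [one_pow, one_mul, pow_mul]
  rw [this]
  exact integrable_finsetSum _ fun k _ => (integrable_pow_gaussian v _).mul_const _

theorem gaussianReal_eq_map_sqrt (v : ℝ≥0) :
    gaussianReal 0 v = (gaussianReal 0 1).map (fun z => √v * z) := by
  rw [gaussianReal_map_const_mul]
  congr 1
  · simp
  · ext; simp

theorem lintegral_gaussianReal_eq (v : ℝ≥0) {f : ℝ → ℝ≥0∞} (hf : Measurable f) :
    ∫⁻ g, f g ∂(gaussianReal 0 v) = ∫⁻ z, f (√v * z) ∂(gaussianReal 0 1) := by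
  rw [gaussianReal_eq_map_sqrt, lintegral_map hf (by fun_prop)]

theorem integral_sq_gaussianReal (v : ℝ≥0) : ∫ z, z ^ 2 ∂(gaussianReal 0 v) = v := by
  have h := variance_fun_id_gaussianReal (μ := 0) (v := v)
  rw [variance_of_integral_eq_zero (by fun_prop) (by simp)] at h
  exact h

/-- Induction: passing from q to q + 1 multiplies the remainder by 1 + ρ and adds qρ², and q² + q ≤
(q + 1)². -/
theorem abs_one_add_pow_sub_le (ρ : ℝ) (q : ℕ) :
    |(1 + ρ) ^ q - 1 - q * ρ| ≤ q ^ 2 * (ρ ^ 2 * (1 + |ρ|) ^ q) := by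
  induction q with
  | zero => simp
  | succ q ih =>
    have h1 : (1 + ρ) ^ (q + 1) - 1 - ((q + 1 : ℕ) : ℝ) * ρ
        = (1 + ρ) * ((1 + ρ) ^ q - 1 - q * ρ) + q * ρ ^ 2 := by
      push_cast; ring
    have h2 : |1 + ρ| ≤ 1 + |ρ| := by simpa using abs_add_le 1 ρ
    have h3 : (1 : ℝ) ≤ (1 + |ρ|) ^ (q + 1) := one_le_pow₀ (by linarith [abs_nonneg ρ])
    rw [h1]
    calc |(1 + ρ) * ((1 + ρ) ^ q - 1 - q * ρ) + q * ρ ^ 2|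
        ≤ |(1 + ρ) * ((1 + ρ) ^ q - 1 - q * ρ)| + |q * ρ ^ 2| := abs_add_le _ _
      _ = |1 + ρ| * |(1 + ρ) ^ q - 1 - q * ρ| + q * ρ ^ 2 := by
          rw [abs_mul, abs_of_nonneg (by positivity : (0 : ℝ) ≤ q * ρ ^ 2)]
      _ ≤ (1 + |ρ|) * (q ^ 2 * (ρ ^ 2 * (1 + |ρ|) ^ q))
          + q * ρ ^ 2 * (1 + |ρ|) ^ (q + 1) := by
          refine add_le_add (by gcongr) ?_
          exact le_mul_of_one_le_right (by positivity) h3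
      _ = (q ^ 2 + q) * (ρ ^ 2 * (1 + |ρ|) ^ (q + 1)) := by ring
      _ ≤ _ := by
          gcongr
          push_cast
          nlinarith [(Nat.cast_nonneg q : (0 : ℝ) ≤ q)]

/-- The remainder of the polynomial `z ↦ V (x + δ z) / V x`, `V x = (1 + x²)^q`, for a Milstein
step `δ` from `x`, after the constant and the centred linear part have been removed. -/
theorem milstein_step_remainder (K T : ℝ) (hK : 0 ≤ K) (q : ℕ) :
    ∃ C : ℝ, 0 ≤ C ∧ ∀ s x A B D z : ℝ, 0 ≤ s → s ≤ √T → |A| ≤ K * (1 + |x|) →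
      |B| ≤ K * (1 + |x|) → |D| ≤ K * (1 + |x|) →
      |(1 + (x + A * s ^ 2 + B * (s * z) + 1 / 2 * D * ((s * z) ^ 2 - s ^ 2)) ^ 2) ^ q
          / (1 + x ^ 2) ^ q - 1
        - q * (2 * x * (B * s * z + 1 / 2 * D * s ^ 2 * (z ^ 2 - 1))) / (1 + x ^ 2)|
        ≤ C * s ^ 2 * (1 + z ^ 2) ^ (4 + 2 * q) := by
  set R := √T with hR
  have hR0 : 0 ≤ R := Real.sqrt_nonneg _
  -- Here s is the square root of the timestep and R absorbs its spare powers. With w = 1 + z², `K1`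
  -- gives |δ| ≤ (1 + |x|) s K1 w for the step, and `K2` gives |ρ| ≤ s K2 w² for the relative change
  -- of 1 + x².
  set K1 := K * (2 * R + 1) with hK1
  have hK10 : 0 ≤ K1 := by positivity
  set K2 := 4 * K1 + 2 * K1 ^ 2 * R with hK2
  have hK20 : 0 ≤ K2 := by positivity
  clear_value R K1 K2
  -- The first summand bounds what remains of the linear term qρ, the second the Taylor remainder of
  -- (1 + ρ)^q.
  refine ⟨q * (4 * K + 2 * K1 ^ 2) + q ^ 2 * (K2 ^ 2 * (1 + R * K2) ^ q), by positivity, ?_⟩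
  intro s x A B D z hs hsR hA hB hD
  set w := 1 + z ^ 2 with hw
  have hw1 : 1 ≤ w := by nlinarith [sq_nonneg z]
  clear_value w
  have hzw : |z| ≤ w := by
    rw [hw, abs_le]; constructor <;> nlinarith [sq_nonneg (z - 1), sq_nonneg (z + 1)]
  set δ := A * s ^ 2 + B * (s * z) + 1 / 2 * D * ((s * z) ^ 2 - s ^ 2) with hδ
  clear_value δ
  have hx1 : (1 + |x|) ^ 2 ≤ 2 * (1 + x ^ 2) := by nlinarith [sq_nonneg (1 - |x|), sq_abs x]
  have hx2 : |x| * (1 + |x|) ≤ 2 * (1 + x ^ 2) := by nlinarith [abs_nonneg x]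
  have hx0 : 0 < 1 + x ^ 2 := by positivity
  have hδb : |δ| ≤ (1 + |x|) * (s * K1 * w) := by
    have e1 : |A * s ^ 2| ≤ (1 + |x|) * (s * (K * R) * w) := by
      rw [abs_mul, abs_of_nonneg (sq_nonneg s)]
      calc |A| * s ^ 2 ≤ (K * (1 + |x|)) * (s * R) := by
            rw [pow_two]; gcongr
        _ = (1 + |x|) * (s * (K * R)) * 1 := by ring
        _ ≤ (1 + |x|) * (s * (K * R)) * w := by gcongr
        _ = _ := by ring
    have e2 : |B * (s * z)| ≤ (1 + |x|) * (s * K * w) := by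
      rw [abs_mul, abs_mul, abs_of_nonneg hs]
      calc |B| * (s * |z|) ≤ (K * (1 + |x|)) * (s * w) := by gcongr
        _ = _ := by ring
    have e3 : |1 / 2 * D * ((s * z) ^ 2 - s ^ 2)| ≤ (1 + |x|) * (s * (K * R) * w) := by
      have : 1 / 2 * D * ((s * z) ^ 2 - s ^ 2) = D * (s * s) * (1 / 2 * (z ^ 2 - 1)) := by ring
      rw [this, abs_mul, abs_mul, abs_of_nonneg (mul_nonneg hs hs)]
      have : |1 / 2 * (z ^ 2 - 1)| ≤ w := by
        rw [hw, abs_le]; constructor <;> nlinarith [sq_nonneg z]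
      calc |D| * (s * s) * |1 / 2 * (z ^ 2 - 1)| ≤ (K * (1 + |x|)) * (s * R) * w := by gcongr
        _ = _ := by ring
    calc |δ| ≤ |A * s ^ 2| + |B * (s * z)| + |1 / 2 * D * ((s * z) ^ 2 - s ^ 2)| :=
          hδ ▸ abs_add_three _ _ _
      _ ≤ _ := by rw [hK1]; linarith
  have hδ2 : δ ^ 2 ≤ 2 * (1 + x ^ 2) * (s ^ 2 * K1 ^ 2 * w ^ 2) := by
    calc δ ^ 2 = |δ| ^ 2 := (sq_abs δ).symm
      _ ≤ ((1 + |x|) * (s * K1 * w)) ^ 2 := by gcongr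
      _ = (1 + |x|) ^ 2 * (s ^ 2 * K1 ^ 2 * w ^ 2) := by ring
      _ ≤ _ := by gcongr
  set ρ := (2 * x * δ + δ ^ 2) / (1 + x ^ 2) with hρ
  clear_value ρ
  have hρb : |ρ| ≤ s * K2 * w ^ 2 := by
    rw [hρ, abs_div, abs_of_pos hx0, div_le_iff₀ hx0]
    calc |2 * x * δ + δ ^ 2| ≤ |2 * x * δ| + |δ ^ 2| := abs_add_le _ _
      _ = 2 * (|x| * |δ|) + δ ^ 2 := by
          rw [abs_mul, abs_mul, abs_two, abs_of_nonneg (sq_nonneg δ)]; ring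
      _ ≤ 2 * (|x| * ((1 + |x|) * (s * K1 * w)))
          + 2 * (1 + x ^ 2) * (s ^ 2 * K1 ^ 2 * w ^ 2) := by gcongr
      _ = 2 * (|x| * (1 + |x|)) * (s * K1 * w)
          + 2 * (1 + x ^ 2) * (s * s * K1 ^ 2 * w ^ 2) := by ring
      _ ≤ 2 * (2 * (1 + x ^ 2)) * (s * K1 * w ^ 2)
          + 2 * (1 + x ^ 2) * (s * R * K1 ^ 2 * w ^ 2) := by
          have : w ≤ w ^ 2 := le_self_pow₀ hw1 two_ne_zero
          gcongr
      _ = _ := by rw [hK2]; ring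
  have hfac : (1 + (x + δ) ^ 2) ^ q / (1 + x ^ 2) ^ q = (1 + ρ) ^ q := by
    rw [← div_pow]
    congr 1
    rw [hρ]
    field_simp
    ring
  -- Once the centred part is removed, only the drift and δ² remain in qρ, and both are of order s².
  have hlin : (q : ℝ) * ρ - q * (2 * x * (B * s * z + 1 / 2 * D * s ^ 2 * (z ^ 2 - 1))) / (1 + x ^ 2)
      = q * ((2 * x * A * s ^ 2 + δ ^ 2) / (1 + x ^ 2)) := by
    rw [hρ]
    have : 2 * x * δ = 2 * x * A * s ^ 2
        + 2 * x * (B * s * z + 1 / 2 * D * s ^ 2 * (z ^ 2 - 1)) := by rw [hδ]; ring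
    rw [this]
    ring
  have hl2 : |(2 * x * A * s ^ 2 + δ ^ 2) / (1 + x ^ 2)| ≤ (4 * K + 2 * K1 ^ 2) * (s ^ 2 * w ^ 2) := by
    rw [abs_div, abs_of_pos hx0, div_le_iff₀ hx0]
    calc |2 * x * A * s ^ 2 + δ ^ 2| ≤ |2 * x * A * s ^ 2| + |δ ^ 2| := abs_add_le _ _
      _ = 2 * (|x| * |A|) * s ^ 2 + δ ^ 2 := by
          rw [abs_mul, abs_mul, abs_mul, abs_two, abs_of_nonneg (sq_nonneg δ),
            abs_of_nonneg (sq_nonneg s)]; ring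
      _ ≤ 2 * (|x| * (K * (1 + |x|))) * s ^ 2 + 2 * (1 + x ^ 2) * (s ^ 2 * K1 ^ 2 * w ^ 2) := by
          gcongr
      _ = 2 * K * (|x| * (1 + |x|)) * s ^ 2 * 1
          + 2 * (1 + x ^ 2) * (s ^ 2 * K1 ^ 2 * w ^ 2) := by ring
      _ ≤ 2 * K * (2 * (1 + x ^ 2)) * s ^ 2 * w ^ 2
          + 2 * (1 + x ^ 2) * (s ^ 2 * K1 ^ 2 * w ^ 2) := by
          have : 1 ≤ w ^ 2 := one_le_pow₀ hw1
          gcongr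
      _ = _ := by ring
  have hr2 : ρ ^ 2 * (1 + |ρ|) ^ q ≤ K2 ^ 2 * (1 + R * K2) ^ q * (s ^ 2 * w ^ (4 + 2 * q)) := by
    have h1 : 1 + |ρ| ≤ (1 + R * K2) * w ^ 2 := by
      have : 1 ≤ w ^ 2 := one_le_pow₀ hw1
      calc 1 + |ρ| ≤ w ^ 2 + R * K2 * w ^ 2 :=
            add_le_add this (hρb.trans (by gcongr))
        _ = _ := by ring
    calc ρ ^ 2 * (1 + |ρ|) ^ q = |ρ| ^ 2 * (1 + |ρ|) ^ q := by rw [sq_abs]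
      _ ≤ (s * K2 * w ^ 2) ^ 2 * ((1 + R * K2) * w ^ 2) ^ q := by gcongr
      _ = _ := by rw [mul_pow _ _ q, ← pow_mul w 2 q, pow_add]; ring
  have hw2 : w ^ 2 ≤ w ^ (4 + 2 * q) := pow_le_pow_right₀ hw1 (by omega)
  have hδ' : x + A * s ^ 2 + B * (s * z) + 1 / 2 * D * ((s * z) ^ 2 - s ^ 2) = x + δ := by
    rw [hδ]; ring
  rw [hδ', hfac]
  calc |(1 + ρ) ^ q - 1 - q * (2 * x * (B * s * z + 1 / 2 * D * s ^ 2 * (z ^ 2 - 1))) / (1 + x ^ 2)|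
      = |((1 + ρ) ^ q - 1 - q * ρ) + q * ((2 * x * A * s ^ 2 + δ ^ 2) / (1 + x ^ 2))| := by
        rw [← hlin]; ring_nf
    _ ≤ |(1 + ρ) ^ q - 1 - q * ρ| + |q * ((2 * x * A * s ^ 2 + δ ^ 2) / (1 + x ^ 2))| :=
        abs_add_le _ _
    _ ≤ q ^ 2 * (ρ ^ 2 * (1 + |ρ|) ^ q)
        + q * ((4 * K + 2 * K1 ^ 2) * (s ^ 2 * w ^ 2)) := by
        rw [abs_mul, Nat.abs_cast]
        gcongr
        exact abs_one_add_pow_sub_le ρ q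
    _ ≤ q ^ 2 * (K2 ^ 2 * (1 + R * K2) ^ q * (s ^ 2 * w ^ (4 + 2 * q)))
        + q * ((4 * K + 2 * K1 ^ 2) * (s ^ 2 * w ^ (4 + 2 * q))) := by gcongr
    _ = _ := by ring

/-- One Milstein step changes the moment function `V x = (1 + x²)^q` by a relative amount of the
order of the timestep, from above and from below. -/
theorem milstein_step_moment (K T : ℝ) (hK : 0 ≤ K) (q : ℕ) :
    ∃ C : ℝ, 0 ≤ C ∧ ∀ (h : ℝ≥0) (x A B D : ℝ), (h : ℝ) ≤ T → |A| ≤ K * (1 + |x|) →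
      |B| ≤ K * (1 + |x|) → |D| ≤ K * (1 + |x|) →
      ∫⁻ g, ENNReal.ofReal ((1 + (x + A * h + B * g + 1 / 2 * D * (g ^ 2 - h)) ^ 2) ^ q)
          ∂(gaussianReal 0 h) ≤ ENNReal.ofReal ((1 + C * h) * (1 + x ^ 2) ^ q) ∧
      ENNReal.ofReal ((1 - C * h) * (1 + x ^ 2) ^ q) ≤
        ∫⁻ g, ENNReal.ofReal ((1 + (x + A * h + B * g + 1 / 2 * D * (g ^ 2 - h)) ^ 2) ^ q)
          ∂(gaussianReal 0 h) := by
  obtain ⟨C, hC0, hC⟩ := milstein_step_remainder K T hK q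
  set I := ∫ z, (1 + z ^ 2) ^ (4 + 2 * q) ∂(gaussianReal 0 1) with hI
  have hI0 : 0 ≤ I := integral_nonneg fun z => by positivity
  refine ⟨C * I, by positivity, fun h x A B D hh hA hB hD => ?_⟩
  set s := √(h : ℝ) with hs
  have hs2 : s ^ 2 = h := Real.sq_sqrt h.coe_nonneg
  have hV : 0 < (1 + x ^ 2) ^ q := by positivity
  set G := fun z : ℝ => (1 + (x + A * s ^ 2 + B * (s * z)
    + 1 / 2 * D * ((s * z) ^ 2 - s ^ 2)) ^ 2) ^ q with hG
  set L := fun z : ℝ => q * (2 * x * (B * s * z + 1 / 2 * D * s ^ 2 * (z ^ 2 - 1))) / (1 + x ^ 2)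
    with hL
  set R := fun z : ℝ => G z / (1 + x ^ 2) ^ q - 1 - L z with hRdef
  have hRb : ∀ z, |R z| ≤ C * s ^ 2 * (1 + z ^ 2) ^ (4 + 2 * q) := fun z =>
    hC s x A B D z (Real.sqrt_nonneg _) (Real.sqrt_le_sqrt hh) hA hB hD
  have hid : Integrable (fun z : ℝ => z) (gaussianReal 0 1) := by
    simpa using integrable_pow_gaussian 1 1
  have hsq := integrable_pow_gaussian 1 2
  have hLe : L = fun z => (q * (2 * x * (B * s)) / (1 + x ^ 2)) * z
      + (q * (2 * x * (1 / 2 * D * s ^ 2)) / (1 + x ^ 2)) * (z ^ 2 - 1) := by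
    funext z; rw [hL]; ring
  have hsq1 : Integrable (fun z : ℝ => z ^ 2 - 1) (gaussianReal 0 1) :=
    hsq.sub (integrable_const 1)
  have hLi : Integrable L (gaussianReal 0 1) := by
    rw [hLe]
    exact (hid.const_mul _).add (hsq1.const_mul _)
  -- The part of order s integrates to zero by E z = 0 and E z² = 1; hence the relative change is of
  -- order s² = h and not √h.
  have hL0 : ∫ z, L z ∂(gaussianReal 0 1) = 0 := by
    rw [hLe, integral_add (hid.const_mul _) (hsq1.const_mul _), integral_const_mul,
      integral_const_mul, integral_sub hsq (integrable_const 1), integral_sq_gaussianReal,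
      integral_id_gaussianReal]
    simp
  have hbi := (integrable_one_add_sq_pow_gaussian 1 (4 + 2 * q)).const_mul (C * s ^ 2)
  have hRi : Integrable R (gaussianReal 0 1) := by
    refine hbi.mono' ?_ (ae_of_all _ hRb)
    refine Continuous.aestronglyMeasurable ?_
    rw [hRdef, hG, hL]
    fun_prop
  have hGe : G = fun z => (1 + x ^ 2) ^ q * (1 + L z + R z) := by
    funext z
    simp only [hRdef]
    field_simp
    ring
  have hGi : Integrable G (gaussianReal 0 1) := by
    rw [hGe]
    exact (((integrable_const 1).add hLi).add hRi).const_mul _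
  have hGI : ∫ z, G z ∂(gaussianReal 0 1) = (1 + x ^ 2) ^ q * (1 + ∫ z, R z ∂(gaussianReal 0 1)) := by
    rw [hGe, integral_const_mul,
      integral_add (f := fun z => 1 + L z) ((integrable_const 1).add hLi) hRi,
      integral_add (integrable_const 1) hLi, hL0]
    simp
  have hRI : |∫ z, R z ∂(gaussianReal 0 1)| ≤ C * I * h := by
    calc |∫ z, R z ∂(gaussianReal 0 1)| ≤ ∫ z, C * s ^ 2 * (1 + z ^ 2) ^ (4 + 2 * q)
          ∂(gaussianReal 0 1) := by
          exact norm_integral_le_of_norm_le (f := R) hbi (ae_of_all _ hRb)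
      _ = C * I * h := by rw [integral_const_mul, hs2, hI]; ring
  have hlint : ∫⁻ g, ENNReal.ofReal ((1 + (x + A * h + B * g + 1 / 2 * D * (g ^ 2 - h)) ^ 2) ^ q)
      ∂(gaussianReal 0 h) = ENNReal.ofReal (∫ z, G z ∂(gaussianReal 0 1)) := by
    rw [lintegral_gaussianReal_eq _ (by fun_prop),
      ofReal_integral_eq_lintegral_ofReal hGi (ae_of_all _ fun z => by simp only [hG]; positivity)]
    simp only [hG, hs2, ← hs]
  rw [abs_le] at hRI
  rw [hlint, hGI]
  constructor
  · refine ENNReal.ofReal_le_ofReal ?_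
    rw [mul_comm]; gcongr; exact hRI.2
  · refine ENNReal.ofReal_le_ofReal ?_
    rw [mul_comm]; gcongr; linarith [hRI.1]

/-- Against the density exp(-z²/2), the integrand leaves exp(-z²/4). -/
theorem lintegral_exp_sq_gaussian_lt_top :
    ∫⁻ z, ENNReal.ofReal (Real.exp (z ^ 2 / 4)) ∂(gaussianReal 0 1) < ∞ := by
  rw [gaussianReal_of_var_ne_zero 0 one_ne_zero,
    lintegral_withDensity_eq_lintegral_mul _ (measurable_gaussianPDF 0 1) (by fun_prop)]
  have hi : Integrable (fun z : ℝ => (√(2 * Real.pi))⁻¹ * Real.exp (-(1 / 4) * z ^ 2)) :=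
    (integrable_exp_neg_mul_sq (by norm_num : (0 : ℝ) < 1 / 4)).const_mul _
  refine lt_of_eq_of_lt (lintegral_congr fun z => ?_) hi.lintegral_lt_top
  rw [Pi.mul_apply, gaussianPDF, ← ENNReal.ofReal_mul (gaussianPDFReal_nonneg _ _ _),
    gaussianPDFReal, mul_assoc, ← Real.exp_add]
  congr 3
  · simp
  · simp; ring

/-- Average over ±g: the exponents exceed βx² by βg² ± 2βxg, and e^u ≥ 1 + u gives a mean factor at
least 1 + βg². This is the submartingale property of exp(βW²). -/
theorem exp_sq_le_lintegral_gaussian (β x : ℝ) (hβ : 0 ≤ β) (v : ℝ≥0) :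
    ENNReal.ofReal (Real.exp (β * x ^ 2))
      ≤ ∫⁻ g, ENNReal.ofReal (Real.exp (β * (x + g) ^ 2)) ∂(gaussianReal 0 v) := by
  have hsymm : ∫⁻ g, ENNReal.ofReal (Real.exp (β * (x - g) ^ 2)) ∂(gaussianReal 0 v)
      = ∫⁻ g, ENNReal.ofReal (Real.exp (β * (x + g) ^ 2)) ∂(gaussianReal 0 v) := by
    have h : (gaussianReal 0 v).map (fun g => -g) = gaussianReal 0 v := by
      rw [gaussianReal_map_neg, neg_zero]
    conv_rhs => rw [← h]
    rw [lintegral_map (by fun_prop) (by fun_prop)]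
    simp only [sub_eq_add_neg]
  have hpt : ∀ g : ℝ, 2 * ENNReal.ofReal (Real.exp (β * x ^ 2))
      ≤ ENNReal.ofReal (Real.exp (β * (x + g) ^ 2))
        + ENNReal.ofReal (Real.exp (β * (x - g) ^ 2)) := fun g => by
    rw [← ENNReal.ofReal_add (by positivity) (by positivity),
      show (2 : ℝ≥0∞) = ENNReal.ofReal 2 by simp, ← ENNReal.ofReal_mul (by norm_num)]
    refine ENNReal.ofReal_le_ofReal ?_
    have e1 : β * (x + g) ^ 2 = β * x ^ 2 + (β * g ^ 2 + 2 * β * x * g) := by ring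
    have e2 : β * (x - g) ^ 2 = β * x ^ 2 + (β * g ^ 2 - 2 * β * x * g) := by ring
    rw [e1, e2, Real.exp_add (β * x ^ 2), Real.exp_add (β * x ^ 2), ← mul_add, mul_comm]
    gcongr
    nlinarith [Real.add_one_le_exp (β * g ^ 2 + 2 * β * x * g),
      Real.add_one_le_exp (β * g ^ 2 - 2 * β * x * g), mul_nonneg hβ (sq_nonneg g)]
  have h2 : 2 * ENNReal.ofReal (Real.exp (β * x ^ 2))
      ≤ 2 * ∫⁻ g, ENNReal.ofReal (Real.exp (β * (x + g) ^ 2)) ∂(gaussianReal 0 v) := by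
    calc 2 * ENNReal.ofReal (Real.exp (β * x ^ 2))
        = ∫⁻ _, 2 * ENNReal.ofReal (Real.exp (β * x ^ 2)) ∂(gaussianReal 0 v) := by simp
      _ ≤ ∫⁻ g, (ENNReal.ofReal (Real.exp (β * (x + g) ^ 2))
          + ENNReal.ofReal (Real.exp (β * (x - g) ^ 2))) ∂(gaussianReal 0 v) := lintegral_mono hpt
      _ = _ := by rw [lintegral_add_left (by fun_prop), hsymm, two_mul]
  exact (ENNReal.mul_le_mul_iff_right two_ne_zero (by simp)).1 h2

/-- The consequences of the standing assumptions on which the moment bounds rest. -/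
structure LinearlyBoundedCoefficients (a b : ℝ → ℝ → ℝ) (T K : ℝ) : Prop where
  nonneg : 0 ≤ K
  measurable_drift : ∀ t, 0 ≤ t → Measurable fun x => a x t
  measurable_vol : ∀ t, 0 ≤ t → Measurable fun x => b x t
  measurable_dS_vol : ∀ t, 0 ≤ t → Measurable fun x => dS b x t
  drift_le : ∀ x, ∀ t ∈ Icc 0 T, |a x t| ≤ K * (1 + |x|)
  vol_le : ∀ x, ∀ t ∈ Icc 0 T, |b x t| ≤ K * (1 + |x|)
  correction_le : ∀ x, ∀ t ∈ Icc 0 T, |dS b x t * b x t| ≤ K * (1 + |x|)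

theorem Assumptions.exists_linearlyBounded {a b : ℝ → ℝ → ℝ} {T : ℝ} (hab : Assumptions a b T) :
    ∃ K, LinearlyBoundedCoefficients a b T K := by
  obtain ⟨K, hK⟩ := hab.growth.2
  have hb : ∀ x, ∀ t ∈ Icc 0 T, K * (1 + |x|) ≤ |K| * (1 + |x|) := fun x t _ => by
    gcongr; exact le_abs_self K
  refine ⟨|K|, abs_nonneg K, fun t ht => (hab.drift_smooth.contDiff_space t ht).continuous.measurable,
    fun t ht => (hab.vol_smooth.contDiff_space t ht).continuous.measurable,
    fun t ht => ((hab.vol_smooth.contDiff_space t ht).continuous_deriv (by norm_num)).measurable,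
    fun x t ht => ?_, fun x t ht => ?_, fun x t ht => ?_⟩
  all_goals
    refine le_trans ?_ (hb x t ht)
    refine le_trans ?_ (hK x t ht)
  · linarith [abs_nonneg (L0 a a x t), abs_nonneg (L1 b a x t), abs_nonneg (b x t),
      abs_nonneg (L0 a b x t), abs_nonneg (L1 b b x t), abs_nonneg (L0 a (L1 b b) x t),
      abs_nonneg (L1 b (L1 b b) x t)]
  · linarith [abs_nonneg (L0 a a x t), abs_nonneg (L1 b a x t), abs_nonneg (a x t),
      abs_nonneg (L0 a b x t), abs_nonneg (L1 b b x t), abs_nonneg (L0 a (L1 b b) x t),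
      abs_nonneg (L1 b (L1 b b) x t)]
  · have : dS b x t * b x t = L1 b b x t := by rw [L1, mul_comm]
    rw [this]
    linarith [abs_nonneg (L0 a a x t), abs_nonneg (L1 b a x t), abs_nonneg (a x t),
      abs_nonneg (L0 a b x t), abs_nonneg (b x t), abs_nonneg (L0 a (L1 b b) x t),
      abs_nonneg (L1 b (L1 b b) x t)]

/-! ### Moments of the Milstein values and of Brownian suprema -/

section

variable {Ω : Type*} [mΩ : MeasurableSpace Ω] {P : Measure Ω} {W : ℝ≥0 → Ω → ℝ}

/-- The indicator of `A` is adjoined to `X` as a further coordinate known at time t₀. -/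
theorem setLIntegral_past_increment [IsProbabilityMeasure P] (hW : IsPreBrownianReal W P)
    (hm : ∀ t, Measurable (W t)) {t₀ : ℝ≥0} (u : ℝ≥0) {β : Type*}
    [MeasurableSpace β] {X : Ω → β} (hX : Measurable[past W t₀] X) {f : β → ℝ → ℝ≥0∞}
    (hf : Measurable (Function.uncurry f)) {A : Set Ω} (hA : MeasurableSet[past W t₀] A) :
    ∫⁻ ω in A, f (X ω) (W (t₀ + u) ω - W t₀ ω) ∂P
      = ∫⁻ ω in A, ∫⁻ g, f (X ω) g ∂(gaussianReal 0 u) ∂P := by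
  have hA' : MeasurableSet A := past_le hm t₀ A hA
  have h1 : Measurable[past W t₀] (A.indicator fun _ => (1 : ℝ≥0∞)) :=
    measurable_const.indicator hA
  have h2 : Measurable[past W t₀] fun ω => (X ω, A.indicator (fun _ => (1 : ℝ≥0∞)) ω) :=
    hX.prodMk h1
  have hf1 : ∀ x, Measurable (f x) := fun x => hf.comp (measurable_const.prodMk measurable_id)
  have key := lintegral_past_increment hW hm u h2 (f := fun p g => p.2 * f p.1 g) (by
    refine Measurable.mul (by fun_prop) (hf.comp (f := fun q : (β × ℝ≥0∞) × ℝ => (q.1.1, q.2))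
      (by fun_prop)))
  rw [← lintegral_indicator hA', ← lintegral_indicator hA']
  convert key using 2
  · ext ω
    by_cases h : ω ∈ A <;> simp [h]
  · ext ω
    rw [lintegral_const_mul _ (hf1 _)]
    by_cases h : ω ∈ A <;> simp [h]

/-- The driving path `t ↦ W t ω`, with real time. -/
abbrev realPath (W : ℝ≥0 → Ω → ℝ) (ω : Ω) (r : ℝ) : ℝ := W r.toNNReal ω

variable {a b : ℝ → ℝ → ℝ} {S₀ T K h : ℝ}

/-- Adaptedness of the scheme. Allowing any t₀ beyond nh keeps the σ-algebra fixed along the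
induction. -/
theorem measurable_past_milstein {Ω : Type*} {W : ℝ≥0 → Ω → ℝ}
    (hc : LinearlyBoundedCoefficients a b T K) (hh : 0 ≤ h) {t₀ : ℝ≥0}
    (n : ℕ) (hn : n * h ≤ t₀) :
    Measurable[past W t₀] fun ω => milstein a b S₀ h (realPath W ω) n := by
  induction n with
  | zero => exact measurable_const
  | succ n ih =>
    have h0 : 0 ≤ n * h := by positivity
    push_cast at hn
    have h1 : n * h ≤ t₀ := by linarith
    have hS := ih h1
    have w1 : Measurable[past W t₀] fun ω => W (n * h).toNNReal ω :=
      measurable_past (Real.toNNReal_le_iff_le_coe.2 h1)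
    have w2 : Measurable[past W t₀] fun ω => W ((n + 1) * h).toNNReal ω :=
      measurable_past (Real.toNNReal_le_iff_le_coe.2 hn)
    have ma := (hc.measurable_drift _ h0).comp hS
    have mb := (hc.measurable_vol _ h0).comp hS
    have md := (hc.measurable_dS_vol _ h0).comp hS
    simp only [Function.comp_def] at ma mb md
    simp only [milstein, realPath]
    have hw := w2.sub w1
    exact ((hS.add (ma.mul_const h)).add (mb.mul hw)).add
      (((md.const_mul (1 / 2)).mul mb).mul ((hw.pow_const 2).sub_const h))

theorem measurable_milstein (hm : ∀ t, Measurable (W t))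
    (hc : LinearlyBoundedCoefficients a b T K) (hh : 0 ≤ h) (n : ℕ) :
    Measurable fun ω => milstein a b S₀ h (realPath W ω) n :=
  (measurable_past_milstein hc hh (t₀ := (n * h).toNNReal) n (Real.le_coe_toNNReal _)).mono
    (past_le hm _) le_rfl

theorem toNNReal_succ_mul (hh : 0 ≤ h) (n : ℕ) :
    ((n + 1) * h).toNNReal = (n * h).toNNReal + h.toNNReal := by
  rw [add_mul, one_mul, Real.toNNReal_add (by positivity) hh]

/-- Conditionally on the past, `V x = (1 + x²)^q` of the Milstein values grows and decays at most
at a relative rate of the order of the timestep. -/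
theorem milstein_setLIntegral_step [IsProbabilityMeasure P] (hW : IsPreBrownianReal W P)
    (hm : ∀ t, Measurable (W t)) (hc : LinearlyBoundedCoefficients a b T K)
    (S₀ : ℝ) (q : ℕ) :
    ∃ C : ℝ, 0 ≤ C ∧ ∀ (h : ℝ) (n : ℕ), 0 ≤ h → h ≤ T → n * h ≤ T →
      ∀ A : Set Ω, MeasurableSet[past W (n * h).toNNReal] A →
      ∫⁻ ω in A, ENNReal.ofReal ((1 + milstein a b S₀ h (realPath W ω) (n + 1) ^ 2) ^ q) ∂P
        ≤ ∫⁻ ω in A, ENNReal.ofReal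
            ((1 + C * h) * (1 + milstein a b S₀ h (realPath W ω) n ^ 2) ^ q) ∂P ∧
      ∫⁻ ω in A, ENNReal.ofReal
            ((1 - C * h) * (1 + milstein a b S₀ h (realPath W ω) n ^ 2) ^ q) ∂P
        ≤ ∫⁻ ω in A, ENNReal.ofReal
            ((1 + milstein a b S₀ h (realPath W ω) (n + 1) ^ 2) ^ q) ∂P := by
  obtain ⟨C, hC0, hC⟩ := milstein_step_moment K T hc.nonneg q
  refine ⟨C, hC0, fun h n hh hhT hn A hA => ?_⟩
  have h0 : 0 ≤ n * h := by positivity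
  have hS : Measurable[past W (n * h).toNNReal] fun ω => milstein a b S₀ h (realPath W ω) n :=
    measurable_past_milstein hc hh n (Real.le_coe_toNNReal _)
  have ma := hc.measurable_drift _ h0
  have mb := hc.measurable_vol _ h0
  have md := hc.measurable_dS_vol _ h0
  obtain ⟨f, hf⟩ : ∃ f : ℝ → ℝ → ℝ≥0∞, f = fun x g =>
      ENNReal.ofReal ((1 + (x + a x (n * h) * (h.toNNReal : ℝ) + b x (n * h) * g
        + 1 / 2 * (dS b x (n * h) * b x (n * h)) * (g ^ 2 - (h.toNNReal : ℝ))) ^ 2) ^ q) :=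
    ⟨_, rfl⟩
  have hfm : Measurable (Function.uncurry f) := by
    simp only [Function.uncurry_def, hf]
    have m1 : Measurable fun p : ℝ × ℝ => a p.1 (n * h) := ma.comp measurable_fst
    have m2 : Measurable fun p : ℝ × ℝ => b p.1 (n * h) := mb.comp measurable_fst
    have m3 : Measurable fun p : ℝ × ℝ => dS b p.1 (n * h) := md.comp measurable_fst
    fun_prop
  have key := setLIntegral_past_increment hW hm h.toNNReal hS hfm hA
  have heq : ∀ ω, ENNReal.ofReal ((1 + milstein a b S₀ h (realPath W ω) (n + 1) ^ 2) ^ q)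
      = f (milstein a b S₀ h (realPath W ω) n)
        (W ((n * h).toNNReal + h.toNNReal) ω - W (n * h).toNNReal ω) := fun ω => by
    simp only [hf, milstein, realPath, toNNReal_succ_mul hh, Real.coe_toNNReal _ hh]
    congr 4
    ring
  have hb := fun ω => hC h.toNNReal (milstein a b S₀ h (realPath W ω) n) _ _ _
    ((Real.coe_toNNReal _ hh).trans_le hhT)
    (hc.drift_le (milstein a b S₀ h (realPath W ω) n) _ ⟨h0, hn⟩)
    (hc.vol_le (milstein a b S₀ h (realPath W ω) n) _ ⟨h0, hn⟩)
    (hc.correction_le (milstein a b S₀ h (realPath W ω) n) _ ⟨h0, hn⟩)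
  rw [lintegral_congr heq, key, hf]
  constructor
  · refine lintegral_mono fun ω => ?_
    simpa only [Real.coe_toNNReal _ hh] using (hb ω).1
  · refine lintegral_mono fun ω => ?_
    simpa only [Real.coe_toNNReal _ hh] using (hb ω).2

theorem one_add_mul_pow_le_exp {C h T : ℝ} (hC : 0 ≤ C) (hh : 0 ≤ h) {n : ℕ} (hn : n * h ≤ T) :
    (1 + C * h) ^ n ≤ Real.exp (C * T) := by
  calc (1 + C * h) ^ n ≤ Real.exp (C * h) ^ n := by
        gcongr; linarith [Real.add_one_le_exp (C * h)]
    _ = Real.exp (C * (n * h)) := by rw [← Real.exp_nat_mul]; ring_nf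
    _ ≤ _ := by gcongr

/-- A discrete Gronwall argument: the one-step bound on the whole space is iterated and (1 + Ch)^n ≤
e^(CT). -/
theorem milstein_moment_le [IsProbabilityMeasure P] (hW : IsPreBrownianReal W P)
    (hm : ∀ t, Measurable (W t)) (hc : LinearlyBoundedCoefficients a b T K)
    (S₀ : ℝ) (q : ℕ) :
    ∃ M : ℝ, 0 ≤ M ∧ ∀ (h : ℝ) (n : ℕ), 0 ≤ h → h ≤ T → n * h ≤ T →
      ∫⁻ ω, ENNReal.ofReal ((1 + milstein a b S₀ h (realPath W ω) n ^ 2) ^ q) ∂P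
        ≤ ENNReal.ofReal M := by
  obtain ⟨C, hC0, hC⟩ := milstein_setLIntegral_step hW hm hc S₀ q
  refine ⟨Real.exp (C * T) * (1 + S₀ ^ 2) ^ q, by positivity, fun h n hh hhT hn => ?_⟩
  have key : ∀ k : ℕ, k * h ≤ T →
      ∫⁻ ω, ENNReal.ofReal ((1 + milstein a b S₀ h (realPath W ω) k ^ 2) ^ q) ∂P
        ≤ ENNReal.ofReal ((1 + C * h) ^ k * (1 + S₀ ^ 2) ^ q) := by
    intro k
    induction k with
    | zero => intro _; simp [milstein]
    | succ k ih =>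
      intro hk
      push_cast at hk
      have hk' : k * h ≤ T := by linarith
      have h1 := (hC h k hh hhT hk' univ MeasurableSet.univ).1
      rw [setLIntegral_univ, setLIntegral_univ] at h1
      refine h1.trans ?_
      have hp : 0 ≤ 1 + C * h := by positivity
      simp_rw [ENNReal.ofReal_mul hp]
      rw [lintegral_const_mul' _ _ ENNReal.ofReal_ne_top, pow_succ', mul_assoc,
        ENNReal.ofReal_mul hp]
      gcongr
      exact ih hk'
  refine (key n hn).trans (ENNReal.ofReal_le_ofReal ?_)
  gcongr
  exact one_add_mul_pow_le_exp hC0 hh hn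

/-- With θ = 1 - Ch for the exponent 2q, the lower one-step bound makes θ^(-n) (1 + x²)^(2q) a
submartingale. It is the square of θ^(-n/2) (1 + x²)^q, to which the maximal inequality applies. -/
theorem milstein_max_moment_le [IsProbabilityMeasure P] (hW : IsPreBrownianReal W P)
    (hm : ∀ t, Measurable (W t)) (hc : LinearlyBoundedCoefficients a b T K)
    (S₀ : ℝ) (q : ℕ) :
    ∃ M δ : ℝ, 0 ≤ M ∧ 0 < δ ∧ ∀ (h : ℝ) (N : ℕ), 0 ≤ h → h ≤ T → h ≤ δ → N * h ≤ T →
      ∫⁻ ω, ⨆ k ∈ Finset.range (N + 1),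
        ENNReal.ofReal ((1 + milstein a b S₀ h (realPath W ω) k ^ 2) ^ q) ∂P
        ≤ ENNReal.ofReal M := by
  obtain ⟨C, hC0, hC⟩ := milstein_setLIntegral_step hW hm hc S₀ (q * 2)
  obtain ⟨M, hM0, hM⟩ := milstein_moment_le hW hm hc S₀ (q * 2)
  -- This δ forces Ch ≤ 1/2, so θ ≥ 1/2 and θ⁻¹ ≤ 1 + 2Ch; the factor e^(2CT) bounds θ^(-N).
  refine ⟨1 + 4 * (Real.exp (2 * C * T) * M), 1 / (2 * C + 1), by positivity, by positivity,
    fun h N hh hhT hhδ hN => ?_⟩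
  rw [le_div_iff₀ (by positivity)] at hhδ
  set θ := 1 - C * h with hθ
  have hθ2 : 1 / 2 ≤ θ := by rw [hθ]; linarith
  have hθ0 : 0 < θ := by linarith
  have hθ1 : θ ≤ 1 := by rw [hθ]; linarith [mul_nonneg hC0 hh]
  have hsθ : 1 ≤ (√θ)⁻¹ := (one_le_inv₀ (Real.sqrt_pos.2 hθ0)).2 (Real.sqrt_le_one.2 hθ1)
  have hinv : θ⁻¹ ≤ 1 + 2 * C * h := by
    rw [inv_le_iff_one_le_mul₀ hθ0, hθ]
    nlinarith [mul_nonneg hC0 hh]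
  set U : ℕ → Ω → ℝ≥0∞ := fun n ω => ENNReal.ofReal ((√θ)⁻¹ ^ n
    * (1 + milstein a b S₀ h (realPath W ω) n ^ 2) ^ q) with hU
  have hU2 : ∀ n ω, U n ω ^ 2 = ENNReal.ofReal (θ⁻¹ ^ n)
      * ENNReal.ofReal ((1 + milstein a b S₀ h (realPath W ω) n ^ 2) ^ (q * 2)) := fun n ω => by
    rw [hU, ← ENNReal.ofReal_mul (by positivity)]
    simp only
    rw [← ENNReal.ofReal_pow (by positivity), mul_pow, ← pow_mul, ← pow_mul, mul_comm n 2,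
      pow_mul _ 2 n, inv_pow, Real.sq_sqrt hθ0.le]
  have hUp : ∀ t₀ : ℝ≥0, ∀ n : ℕ, n * h ≤ t₀ → Measurable[past W t₀] (U n) := fun t₀ n hn => by
    have := measurable_past_milstein (W := W) (S₀ := S₀) hc hh n hn
    exact ((((this.pow_const 2).const_add 1).pow_const q).const_mul _).ennreal_ofReal
  have hUm : ∀ n, Measurable (U n) := fun n =>
    (hUp (n * h).toNNReal n (Real.le_coe_toNNReal _)).mono (past_le hm _) le_rfl
  calc ∫⁻ ω, ⨆ k ∈ Finset.range (N + 1),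
        ENNReal.ofReal ((1 + milstein a b S₀ h (realPath W ω) k ^ 2) ^ q) ∂P
      ≤ ∫⁻ ω, ⨆ k ∈ Finset.range (N + 1), U k ω ∂P := by
        refine lintegral_mono fun ω => iSup₂_mono fun k _ => ENNReal.ofReal_le_ofReal ?_
        exact le_mul_of_one_le_left (by positivity) (one_le_pow₀ hsθ)
    _ ≤ 1 + 4 * ∫⁻ ω, U N ω ^ 2 ∂P := by
        refine lintegral_iSup_le_of_sq_submartingale hUm N fun c n hn => ?_
        have hnT : n * h ≤ T := le_trans (by gcongr) hN
        have hA : MeasurableSet[past W (n * h).toNNReal] {ω | ∃ k ≤ n, c ≤ U k ω} := by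
          have : {ω | ∃ k ≤ n, c ≤ U k ω} = ⋃ k ∈ Finset.range (n + 1), {ω | c ≤ U k ω} := by
            ext; simp
          rw [this]
          refine Finset.measurableSet_biUnion _ fun k hk => ?_
          refine measurableSet_le measurable_const (hUp _ k ?_)
          rw [Real.coe_toNNReal _ (by positivity)]
          have : k ≤ n := by simpa using hk
          gcongr
        have h1 := (hC h n hh hhT hnT _ hA).2
        simp_rw [hU2]
        rw [lintegral_const_mul' _ _ ENNReal.ofReal_ne_top,
          lintegral_const_mul' _ _ ENNReal.ofReal_ne_top]
        simp only [← hθ, ENNReal.ofReal_mul hθ0.le] at h1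
        rw [lintegral_const_mul' _ _ ENNReal.ofReal_ne_top] at h1
        have h2 : ENNReal.ofReal (θ⁻¹ ^ n) = ENNReal.ofReal (θ⁻¹ ^ (n + 1)) * ENNReal.ofReal θ := by
          rw [← ENNReal.ofReal_mul (by positivity), pow_succ, mul_assoc,
            inv_mul_cancel₀ hθ0.ne', mul_one]
        rw [h2, mul_assoc]
        gcongr
    _ ≤ 1 + 4 * (ENNReal.ofReal (Real.exp (2 * C * T)) * ENNReal.ofReal M) := by
        simp_rw [hU2]
        rw [lintegral_const_mul' _ _ ENNReal.ofReal_ne_top]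
        gcongr
        · exact (pow_le_pow_left₀ (by positivity) hinv N).trans
            (one_add_mul_pow_le_exp (by positivity) hh hN)
        · exact hM h N hh hhT hN
    _ = _ := by
        rw [ENNReal.ofReal_add (by norm_num) (by positivity), ENNReal.ofReal_mul (by norm_num),
          ENNReal.ofReal_mul (by positivity)]
        simp

/-- Brownian suprema over an interval have square-exponential moments. -/
theorem exists_measurable_iSup_exp_sq_le [IsProbabilityMeasure P] (hW : IsPreBrownianReal W P)
    (hm : ∀ t, Measurable (W t)) (hcont : ∀ ω, Continuous (W · ω)) {h : ℝ≥0} (hh : 0 < h) :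
    ∃ E : Ω → ℝ≥0∞, Measurable E ∧
      (∀ ω, ∀ u ≤ h, ENNReal.ofReal (Real.exp (W u ω ^ 2 / (8 * h))) ≤ E ω) ∧
      ∫⁻ ω, E ω ∂P
        ≤ 1 + 4 * ∫⁻ z, ENNReal.ofReal (Real.exp (z ^ 2 / 4)) ∂(gaussianReal 0 1) := by
  have hh' : (0 : ℝ) < h := hh
  -- The maximal inequality uses the square exp(W²/(4h)), which at time h is exp(z²/4) for a
  -- standard normal z: this fixes the 8.
  set F : ℝ≥0 → Ω → ℝ≥0∞ := fun u ω => ENNReal.ofReal (Real.exp (W u ω ^ 2 / (8 * h))) with hF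
  have hF2 : ∀ u ω, F u ω ^ 2 = ENNReal.ofReal (Real.exp (1 / (4 * h) * W u ω ^ 2)) := fun u ω => by
    rw [hF]
    simp only
    rw [← ENNReal.ofReal_pow (by positivity), ← Real.exp_nat_mul]
    congr 2
    push_cast
    field_simp
    ring
  have hFm : ∀ u, Measurable (F u) := fun u => by
    have := hm u
    simp only [hF]
    fun_prop
  have hFc : ∀ ω, Continuous fun u => F u ω := fun ω => by
    have := hcont ω
    simp only [hF]
    exact ENNReal.continuous_ofReal.comp (by fun_prop)
  have hgrid : ∀ (δ : ℝ≥0) (N : ℕ), N * δ = h →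
      ∫⁻ ω, ⨆ k ∈ Finset.range (N + 1), F (k * δ) ω ∂P
        ≤ 1 + 4 * ∫⁻ z, ENNReal.ofReal (Real.exp (z ^ 2 / 4)) ∂(gaussianReal 0 1) := by
    intro δ N hN
    refine (lintegral_iSup_le_of_sq_submartingale (U := fun k ω => F (k * δ) ω)
      (fun k => hFm _) N fun c n hn => ?_).trans ?_
    · have hA : MeasurableSet[past W (n * δ)] {ω | ∃ k ≤ n, c ≤ F (k * δ) ω} := by
        have : {ω | ∃ k ≤ n, c ≤ F (k * δ) ω}
            = ⋃ k ∈ Finset.range (n + 1), {ω | c ≤ F (k * δ) ω} := by ext; simp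
        rw [this]
        refine Finset.measurableSet_biUnion _ fun k hk => ?_
        have hk : k ≤ n := by simpa using hk
        have : Measurable[past W (n * δ)] (W (k * δ)) := measurable_past (by gcongr)
        exact measurableSet_le measurable_const
          (Real.measurable_exp.comp ((this.pow_const 2).div_const _)).ennreal_ofReal
      have key := setLIntegral_past_increment hW hm δ (measurable_past (le_refl (n * δ)))
        (f := fun x g => ENNReal.ofReal (Real.exp (1 / (4 * h) * (x + g) ^ 2))) (by
          simp only [Function.uncurry_def]; fun_prop) hA
      have hcast : ((n + 1 : ℕ) : ℝ≥0) * δ = n * δ + δ := by push_cast; ring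
      simp only [hF2, hcast]
      simp only [add_sub_cancel] at key
      rw [key]
      exact lintegral_mono fun ω => exp_sq_le_lintegral_gaussian _ _ (by positivity) _
    · have hlaw := (hW.hasLaw_eval h)
      simp only [hN, hF2]
      gcongr
      rw [← lintegral_map (f := fun x => ENNReal.ofReal (Real.exp (1 / (4 * (h : ℝ)) * x ^ 2)))
        (by fun_prop) (hm h), hlaw.map_eq, lintegral_gaussianReal_eq _ (by fun_prop)]
      refine lintegral_mono fun z => ENNReal.ofReal_le_ofReal (Real.exp_le_exp.2 (le_of_eq ?_))
      rw [mul_pow, Real.sq_sqrt h.coe_nonneg]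
      field_simp
  -- Dyadic grids are nested, so monotone convergence passes to their union; path continuity then
  -- reaches every u ≤ h.
  set G : ℕ → Ω → ℝ≥0∞ := fun r ω => ⨆ k ∈ Finset.range (2 ^ r + 1), F (k * (h / 2 ^ r)) ω with hG
  have hGmono : Monotone G := by
    refine monotone_nat_of_le_succ fun r ω => iSup₂_le fun k hk => ?_
    have hk : k ≤ 2 ^ r := by simpa [Nat.lt_succ_iff] using hk
    refine le_iSup₂_of_le (2 * k) (by simp [pow_succ]; omega) (le_of_eq ?_)
    congr 1
    push_cast
    rw [pow_succ]
    field_simp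
  have hGm : ∀ r, Measurable (G r) := fun r =>
    Measurable.iSup fun k => Measurable.iSup fun _ => hFm _
  have hle : ∀ ω, ∀ u ≤ h, F u ω ≤ ⨆ r, G r ω := fun ω u hu => by
    have htend : Tendsto (fun r : ℕ => (⌊(u : ℝ) * 2 ^ r / h⌋₊ : ℝ≥0) * (h / 2 ^ r)) atTop (nhds u) := by
      have h0 : Tendsto (fun r : ℕ => (2 : ℝ) ^ r) atTop atTop :=
        tendsto_pow_atTop_atTop_of_one_lt (by norm_num)
      have h1 : Tendsto (fun r : ℕ => (2 : ℝ) ^ r / h) atTop atTop :=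
        h0.atTop_div_const hh'
      have h2 := (tendsto_nat_floor_mul_div_atTop (R := ℝ) u.coe_nonneg).comp h1
      rw [← NNReal.tendsto_coe]
      refine h2.congr fun r => ?_
      simp only [Function.comp_apply]
      push_cast
      rw [mul_div_assoc, div_eq_mul_inv (⌊_⌋₊ : ℝ), inv_div]
    refine le_of_tendsto (((hFc ω).tendsto u).comp htend) (Eventually.of_forall fun r => ?_)
    refine le_iSup_of_le r (le_iSup₂_of_le ⌊(u : ℝ) * 2 ^ r / h⌋₊ ?_ le_rfl)
    rw [Finset.mem_range, Nat.lt_succ_iff]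
    refine Nat.floor_le_of_le ?_
    rw [div_le_iff₀ hh']
    push_cast
    rw [mul_comm]
    gcongr
  refine ⟨fun ω => ⨆ r, G r ω, Measurable.iSup hGm, hle, ?_⟩
  rw [lintegral_iSup hGm hGmono]
  exact iSup_le fun r => hgrid (h / 2 ^ r) (2 ^ r) (by push_cast; field_simp)

end

/-! ### The difference on one cell; pointwise moments and the running supremum -/

section

variable {Ω : Type*} [mΩ : MeasurableSpace Ω] {P : Measure Ω} {W : ℝ≥0 → Ω → ℝ}
  {a b : ℝ → ℝ → ℝ} {S₀ T K : ℝ} {N : ℕ}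

/-- The difference of the interpolants at time `t`, written on the cell with index `n`. -/
noncomputable def cellDiff (a b : ℝ → ℝ → ℝ) (S₀ h : ℝ) (W : ℝ≥0 → Ω → ℝ) (n : ℕ) (t : ℝ) (ω : Ω) : ℝ :=
  1 / 2 * (dS b (milstein a b S₀ h (realPath W ω) n) (n * h)
      * b (milstein a b S₀ h (realPath W ω) n) (n * h))
    * ((t - n * h) / h * (realPath W ω ((n + 1) * h) - realPath W ω (n * h)) ^ 2
      - (realPath W ω t - realPath W ω (n * h)) ^ 2)

/-- The drift and linear terms agree, and in the quadratic terms λh = t - t_n cancels the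
compensators. -/
theorem interpolantDiff_eq_cellDiff {Ω : Type*} {W : ℝ≥0 → Ω → ℝ} (hT : 0 < T) (hN : 0 < N)
    (t : ℝ) (ω : Ω) :
    interpolantDiff a b S₀ T W N t ω = cellDiff a b S₀ (T / N) W ⌊t / (T / N)⌋₊ t ω := by
  have hh : (T / N : ℝ) ≠ 0 := by positivity
  simp only [interpolantDiff, bridgeInterpolant, kpInterpolant, cellDiff, milstein, realPath]
  generalize (T / N : ℝ) = h at *
  field_simp
  ring

theorem cell_bounds {h t : ℝ} (hh : 0 < h) (ht : 0 ≤ t) :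
    ⌊t / h⌋₊ * h ≤ t ∧ t < (⌊t / h⌋₊ + 1) * h := by
  constructor
  · rw [← le_div_iff₀ hh]
    exact Nat.floor_le (by positivity)
  · rw [← div_lt_iff₀ hh]
    exact Nat.lt_floor_add_one _

theorem abs_cellDiff_le {Ω : Type*} {W : ℝ≥0 → Ω → ℝ} (hc : LinearlyBoundedCoefficients a b T K) {h t : ℝ} (hh : 0 < h) {n : ℕ}
    (h1 : n * h ≤ t) (h2 : t ≤ (n + 1) * h) (hn : n * h ≤ T) (ω : Ω) :
    |cellDiff a b S₀ h W n t ω| ≤ K * (1 + |milstein a b S₀ h (realPath W ω) n|)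
      * ((realPath W ω ((n + 1) * h) - realPath W ω (n * h)) ^ 2
        + (realPath W ω t - realPath W ω (n * h)) ^ 2) := by
  have hcorr := hc.correction_le (milstein a b S₀ h (realPath W ω) n) (n * h) ⟨by positivity, hn⟩
  have hK := hc.nonneg
  rw [cellDiff, abs_mul, abs_mul, abs_of_pos (by norm_num : (0 : ℝ) < 1 / 2)]
  refine mul_le_mul ?_ ?_ (abs_nonneg _) (by positivity)
  · linarith [abs_nonneg (dS b (milstein a b S₀ h (realPath W ω) n) (n * h)
      * b (milstein a b S₀ h (realPath W ω) n) (n * h))]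
  · have hl0 : 0 ≤ (t - n * h) / h := div_nonneg (by linarith) hh.le
    have hl1 : (t - n * h) / h ≤ 1 := by rw [div_le_one hh]; linarith
    generalize (t - n * h) / h = l at *
    generalize realPath W ω ((n + 1) * h) - realPath W ω (n * h) = x
    generalize realPath W ω t - realPath W ω (n * h) = y
    rw [abs_le]
    constructor <;> nlinarith [sq_nonneg x, sq_nonneg y, mul_nonneg hl0 (sq_nonneg x),
      mul_nonneg (sub_nonneg.2 hl1) (sq_nonneg x)]

/-- Young's inequality separates the size of the Milstein value from the size of the driving path
on the cell. -/
theorem abs_cellDiff_pow_le {Ω : Type*} {W : ℝ≥0 → Ω → ℝ}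
    (hc : LinearlyBoundedCoefficients a b T K) {h t : ℝ} (hh : 0 < h)
    {n : ℕ} (h1 : n * h ≤ t) (h2 : t ≤ (n + 1) * h) (hn : n * h ≤ T) (ω : Ω) (m : ℕ) {ε : ℝ}
    (hε : 0 < ε) :
    |cellDiff a b S₀ h W n t ω| ^ m
      ≤ (2 * K ^ 2) ^ m * ε ^ m * (1 + milstein a b S₀ h (realPath W ω) n ^ 2) ^ m
        + (ε ^ m)⁻¹ * ((realPath W ω ((n + 1) * h) - realPath W ω (n * h)) ^ 2
        + (realPath W ω t - realPath W ω (n * h)) ^ 2) ^ (2 * m) := by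
  have hb := abs_cellDiff_le (S₀ := S₀) (W := W) hc hh h1 h2 hn ω
  have hK := hc.nonneg
  generalize milstein a b S₀ h (realPath W ω) n = x at *
  generalize (realPath W ω ((n + 1) * h) - realPath W ω (n * h)) ^ 2
        + (realPath W ω t - realPath W ω (n * h)) ^ 2 = Q at *
  have hx : (1 + |x|) ^ 2 ≤ 2 * (1 + x ^ 2) := by nlinarith [sq_nonneg (1 - |x|), sq_abs x]
  have hp : ((K * (1 + |x|)) ^ m) ^ 2 ≤ (2 * K ^ 2) ^ m * (1 + x ^ 2) ^ m := by
    calc ((K * (1 + |x|)) ^ m) ^ 2 = (K ^ 2 * (1 + |x|) ^ 2) ^ m := by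
          rw [← pow_mul, mul_comm m 2, pow_mul, mul_pow]
      _ ≤ (K ^ 2 * (2 * (1 + x ^ 2))) ^ m := by gcongr
      _ = _ := by rw [← mul_pow]; ring_nf
  calc |cellDiff a b S₀ h W n t ω| ^ m ≤ (K * (1 + |x|) * Q) ^ m := by gcongr
    _ = (K * (1 + |x|)) ^ m * Q ^ m := mul_pow _ _ _
    -- Young's inequality with weight ε^m, from the nonnegativity of a sum of squares. The free ε is
    -- taken as h for fixed times and as h log N for the supremum.
    _ ≤ ε ^ m * ((K * (1 + |x|)) ^ m) ^ 2 + (ε ^ m)⁻¹ * (Q ^ m) ^ 2 := by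
        have hε' : 0 < ε ^ m := by positivity
        generalize (K * (1 + |x|)) ^ m = p
        generalize Q ^ m = r
        generalize ε ^ m = e at *
        have hkey : 0 ≤ e⁻¹ * ((e * p - r) ^ 2 + (e * p) ^ 2 + r ^ 2) := by positivity
        have hexp : e⁻¹ * ((e * p - r) ^ 2 + (e * p) ^ 2 + r ^ 2)
            = 2 * (e * p ^ 2 + e⁻¹ * r ^ 2 - p * r) := by field_simp; ring
        linarith
    _ ≤ _ := by
        rw [mul_comm 2 m, pow_mul]
        have : ε ^ m * ((K * (1 + |x|)) ^ m) ^ 2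
            ≤ ε ^ m * ((2 * K ^ 2) ^ m * (1 + x ^ 2) ^ m) := by gcongr
        linarith

theorem lintegral_pow_gaussianReal (v : ℝ≥0) (k : ℕ) :
    ∫⁻ g, ENNReal.ofReal (g ^ (2 * k)) ∂(gaussianReal 0 v)
      = ENNReal.ofReal ((v : ℝ) ^ k * ∫ z, z ^ (2 * k) ∂(gaussianReal 0 1)) := by
  rw [lintegral_gaussianReal_eq _ (by fun_prop), ENNReal.ofReal_mul (by positivity),
    ofReal_integral_eq_lintegral_ofReal (integrable_pow_gaussian 1 _)
      (ae_of_all _ fun z => (even_two_mul k).pow_nonneg z), ← lintegral_const_mul _ (by fun_prop)]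
  refine lintegral_congr fun z => ?_
  rw [← ENNReal.ofReal_mul (by positivity), mul_pow, pow_mul (√(v : ℝ)), Real.sq_sqrt v.coe_nonneg]

theorem hasLaw_realPath_sub (hW : IsPreBrownianReal W P) {s t : ℝ} (hs : 0 ≤ s) (hst : s ≤ t) :
    HasLaw (fun ω => realPath W ω t - realPath W ω s) (gaussianReal 0 (t - s).toNNReal) P := by
  have h := (hW.shift s.toNNReal).hasLaw_eval (t - s).toNNReal
  rw [← Real.toNNReal_add hs (by linarith)] at h
  simpa using h

theorem lintegral_realPath_sub_pow_le (hW : IsPreBrownianReal W P) {s t h : ℝ} (hs : 0 ≤ s)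
    (hst : s ≤ t) (hth : t - s ≤ h) (k : ℕ) :
    ∫⁻ ω, ENNReal.ofReal ((realPath W ω t - realPath W ω s) ^ (2 * k)) ∂P
      ≤ ENNReal.ofReal (h ^ k * ∫ z, z ^ (2 * k) ∂(gaussianReal 0 1)) := by
  rw [(hasLaw_realPath_sub hW hs hst).lintegral_comp
    (f := fun g => ENNReal.ofReal (g ^ (2 * k))) (by fun_prop), lintegral_pow_gaussianReal]
  refine ENNReal.ofReal_le_ofReal ?_
  have : 0 ≤ ∫ z, z ^ (2 * k) ∂(gaussianReal 0 1) :=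
    integral_nonneg fun z => (even_two_mul k).pow_nonneg z
  gcongr
  rwa [Real.coe_toNNReal _ (by linarith)]

theorem measurable_realPath (hm : ∀ t, Measurable (W t)) (t : ℝ) :
    Measurable fun ω => realPath W ω t := hm _

/-- Moments of the difference of the interpolants, uniformly in time and in the timestep. -/
theorem interpolantDiff_moment_le [IsProbabilityMeasure P] (hW : IsPreBrownianReal W P)
    (hm : ∀ t, Measurable (W t)) (hT : 0 < T) (hc : LinearlyBoundedCoefficients a b T K)
    (S₀ : ℝ) (m : ℕ) :
    ∃ C : ℝ, 0 ≤ C ∧ ∀ N : ℕ, 0 < N → ∀ t ∈ Icc 0 T,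
      ∫⁻ ω, ENNReal.ofReal (|interpolantDiff a b S₀ T W N t ω| ^ m) ∂P
        ≤ ENNReal.ofReal (C * (T / N) ^ m) := by
  obtain ⟨M, hM0, hM⟩ := milstein_moment_le hW hm hc S₀ m
  set μ := ∫ z, z ^ (2 * (2 * m)) ∂(gaussianReal 0 1) with hμ
  have hμ0 : 0 ≤ μ := integral_nonneg fun z => (even_two_mul _).pow_nonneg z
  have hK := hc.nonneg
  refine ⟨(2 * K ^ 2) ^ m * M + 2 ^ (2 * m - 1) * (μ + μ), by positivity, fun N hN t ht => ?_⟩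
  have hN' : (1 : ℝ) ≤ N := by exact_mod_cast hN
  simp_rw [interpolantDiff_eq_cellDiff hT hN]
  have hh : 0 < T / N := by positivity
  have hhT : T / N ≤ T := div_le_self hT.le hN'
  generalize (T / N : ℝ) = h at *
  obtain ⟨h1, h2⟩ := cell_bounds hh ht.1
  generalize ⌊t / h⌋₊ = n at *
  have hn : n * h ≤ T := h1.trans ht.2
  have hn0 : 0 ≤ n * h := by positivity
  have mS := measurable_milstein (S₀ := S₀) hm hc hh.le n
  have m1 := measurable_realPath hm ((n + 1) * h)
  have m2 := measurable_realPath hm (n * h)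
  have m3 := measurable_realPath hm t
  have e1 := lintegral_realPath_sub_pow_le hW hn0 (show n * h ≤ (n + 1) * h by linarith)
    (show (n + 1) * h - n * h ≤ h by linarith) (2 * m)
  have e2 := lintegral_realPath_sub_pow_le hW hn0 h1
    (show t - n * h ≤ h by linarith) (2 * m)
  calc ∫⁻ ω, ENNReal.ofReal (|cellDiff a b S₀ h W n t ω| ^ m) ∂P
      ≤ ∫⁻ ω, (ENNReal.ofReal ((2 * K ^ 2) ^ m * h ^ m)
            * ENNReal.ofReal ((1 + milstein a b S₀ h (realPath W ω) n ^ 2) ^ m)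
          + ENNReal.ofReal ((h ^ m)⁻¹ * 2 ^ (2 * m - 1))
            * (ENNReal.ofReal ((realPath W ω ((n + 1) * h) - realPath W ω (n * h)) ^ (2 * (2 * m)))
              + ENNReal.ofReal ((realPath W ω t - realPath W ω (n * h)) ^ (2 * (2 * m))))) ∂P := by
        refine lintegral_mono fun ω => ?_
        have p1 := (even_two_mul (2 * m)).pow_nonneg
          (realPath W ω ((n + 1) * h) - realPath W ω (n * h))
        have p2 := (even_two_mul (2 * m)).pow_nonneg (realPath W ω t - realPath W ω (n * h))
        rw [← ENNReal.ofReal_mul (by positivity), ← ENNReal.ofReal_add p1 p2,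
          ← ENNReal.ofReal_mul (by positivity), ← ENNReal.ofReal_add (by positivity)
          (mul_nonneg (by positivity) (add_nonneg p1 p2))]
        -- With ε = h the two terms balance: the increment factor has expectation O(h^(2m)) and is
        -- divided by h^m.
        refine ENNReal.ofReal_le_ofReal
          ((abs_cellDiff_pow_le hc hh h1 h2.le hn ω m hh).trans ?_)
        rw [mul_assoc (h ^ m)⁻¹]
        gcongr
        have := add_pow_le (sq_nonneg (realPath W ω ((n + 1) * h) - realPath W ω (n * h)))
          (sq_nonneg (realPath W ω t - realPath W ω (n * h))) (2 * m)
        simpa only [← pow_mul] using this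
    _ ≤ ENNReal.ofReal ((2 * K ^ 2) ^ m * h ^ m) * ENNReal.ofReal M
          + ENNReal.ofReal ((h ^ m)⁻¹ * 2 ^ (2 * m - 1))
            * (ENNReal.ofReal (h ^ (2 * m) * μ) + ENNReal.ofReal (h ^ (2 * m) * μ)) := by
        rw [lintegral_add_left (by fun_prop), lintegral_const_mul _ (by fun_prop),
          lintegral_const_mul _ (by fun_prop), lintegral_add_left (by fun_prop)]
        gcongr
        exact hM h n hh.le hhT hn
    _ = _ := by
        rw [← ENNReal.ofReal_mul (by positivity), ← ENNReal.ofReal_add (by positivity)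
          (by positivity), ← ENNReal.ofReal_mul (by positivity), ← ENNReal.ofReal_add
          (by positivity) (by positivity)]
        congr 1
        rw [mul_comm 2 m, pow_mul h]
        field_simp

/-- Either y ≤ 2L, or e^(y/2) ≤ e^(-L) e^y. With L = log N the factor e^(-L) = 1/N pays for the
later sum over cells. -/
theorem pow_le_add_exp (k : ℕ) {y L : ℝ} (hy : 0 ≤ y) (hL : 0 ≤ L) :
    y ^ k ≤ (2 * L) ^ k + 2 ^ k * k.factorial * Real.exp (-L) * Real.exp y := by
  have hr : 0 ≤ 2 ^ k * k.factorial * Real.exp (-L) * Real.exp y := by positivity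
  rcases le_or_gt y (2 * L) with h | h
  · have : y ^ k ≤ (2 * L) ^ k := by gcongr
    linarith
  · have h1 := Real.pow_div_factorial_le_exp (y / 2) (by linarith) k
    rw [div_le_iff₀ (by positivity), div_pow, div_le_iff₀ (by positivity)] at h1
    have h2 : Real.exp (y / 2) ≤ Real.exp (-L) * Real.exp y := by
      rw [← Real.exp_add]
      exact Real.exp_le_exp.2 (by linarith)
    calc y ^ k ≤ Real.exp (y / 2) * k.factorial * 2 ^ k := h1
      _ ≤ Real.exp (-L) * Real.exp y * k.factorial * 2 ^ k := by gcongr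
      _ = 2 ^ k * k.factorial * Real.exp (-L) * Real.exp y := by ring
      _ ≤ _ := by
        have : 0 ≤ (2 * L) ^ k := by positivity
        linarith

/-- The expected running supremum of the difference of the interpolants, with the logarithm taken
of the number of timesteps. -/
theorem interpolantDiff_iSup_le [IsProbabilityMeasure P] (hW : IsPreBrownianReal W P)
    (hm : ∀ t, Measurable (W t)) (hcont : ∀ ω, Continuous (W · ω)) (hT : 0 < T)
    (hc : LinearlyBoundedCoefficients a b T K) (S₀ : ℝ) (m : ℕ) :
    ∃ C : ℝ, 0 ≤ C ∧ ∀ᶠ N : ℕ in atTop,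
      ∫⁻ ω, (⨆ t ∈ Icc 0 T, ENNReal.ofReal (|interpolantDiff a b S₀ T W N t ω| ^ m)) ∂P
        ≤ ENNReal.ofReal (C * (T / N * Real.log N) ^ m) := by
  obtain ⟨M, δ, hM0, hδ, hM⟩ := milstein_max_moment_le hW hm hc S₀ m
  obtain ⟨κ, hκ0, hκ⟩ : ∃ κ : ℝ, 0 ≤ κ ∧
      1 + 4 * ∫⁻ z, ENNReal.ofReal (Real.exp (z ^ 2 / 4)) ∂(gaussianReal 0 1)
        = ENNReal.ofReal κ := by
    refine ⟨_, ENNReal.toReal_nonneg, (ENNReal.ofReal_toReal ?_).symm⟩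
    have := lintegral_exp_sq_gaussian_lt_top.ne
    finiteness
  have hK := hc.nonneg
  set c := (2 : ℝ) ^ (2 * m) * (2 * m).factorial with hcdef
  have hc0 : 0 ≤ c := by positivity
  -- The summands come from the maximum of the Milstein values, from the range y ≤ 2L (32 = 16 · 2),
  -- and from the exponential tail, where 2 bounds (N + 1)/N.
  refine ⟨(2 * K ^ 2) ^ m * M + 32 ^ (2 * m) + 16 ^ (2 * m) * c * 2 * κ, by positivity, ?_⟩
  have hlim : Tendsto (fun N : ℕ => T / (N : ℝ)) atTop (nhds 0) :=
    tendsto_const_div_atTop_nhds_zero_nat T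
  have hlog : Tendsto (fun N : ℕ => Real.log N) atTop atTop :=
    Real.tendsto_log_atTop.comp tendsto_natCast_atTop_atTop
  filter_upwards [eventually_gt_atTop 0, hlim.eventually_le_const hδ,
    hlog.eventually_ge_atTop 1] with N hN hhδ hL
  have hN1 : (1 : ℝ) ≤ N := by exact_mod_cast hN
  have hh : 0 < T / N := by positivity
  have hhT : T / N ≤ T := div_le_self hT.le hN1
  have hNh : N * (T / N) = T := by field_simp
  simp_rw [interpolantDiff_eq_cellDiff hT hN]
  have hexpL : Real.exp (-Real.log N) = (N : ℝ)⁻¹ := by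
    rw [Real.exp_neg, Real.exp_log (by positivity)]
  generalize (T / N : ℝ) = h at *
  generalize Real.log N = L at *
  have hL0 : 0 < L := by linarith
  -- The Brownian motion is restarted at t_n, giving each cell its own majorant with the same
  -- expectation bound.
  have hE : ∀ n : ℕ, ∃ E : Ω → ℝ≥0∞, Measurable E ∧
      (∀ ω, ∀ u ≤ h.toNNReal, ENNReal.ofReal (Real.exp
        ((W ((n * h).toNNReal + u) ω - W (n * h).toNNReal ω) ^ 2 / (8 * h.toNNReal))) ≤ E ω) ∧
      ∫⁻ ω, E ω ∂P ≤ ENNReal.ofReal κ := fun n => by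
    have := exists_measurable_iSup_exp_sq_le (hW.shift (n * h).toNNReal)
      (fun t => (hm _).sub (hm _)) (fun ω => by have := hcont ω; fun_prop)
      (Real.toNNReal_pos.2 hh)
    rwa [hκ] at this
  choose E hEm hEb hEi using hE
  have hEb' : ∀ n : ℕ, ∀ ω, ∀ t, n * h ≤ t → t ≤ (n + 1) * h → ENNReal.ofReal (Real.exp
      ((realPath W ω t - realPath W ω (n * h)) ^ 2 / (8 * h))) ≤ E n ω := by
    intro n ω t h1 h2
    have := hEb n ω (t - n * h).toNNReal (Real.toNNReal_le_toNNReal (by linarith))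
    rwa [← Real.toNNReal_add (by positivity) (by linarith), add_sub_cancel,
      Real.coe_toNNReal _ hh.le] at this
  set V : Ω → ℝ≥0∞ := fun ω => ⨆ k ∈ Finset.range (N + 1),
    ENNReal.ofReal ((1 + milstein a b S₀ h (realPath W ω) k ^ 2) ^ m) with hV
  have hVm : Measurable V := by
    refine Measurable.iSup fun k => Measurable.iSup fun _ => ?_
    have := measurable_milstein (S₀ := S₀) hm hc hh.le k
    fun_prop
  -- The majorant is measurable, so measurability of the supremum over t is not needed.
  have hpt : ∀ ω, (⨆ t ∈ Icc 0 T, ENNReal.ofReal (|cellDiff a b S₀ h W ⌊t / h⌋₊ t ω| ^ m))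
      ≤ ENNReal.ofReal ((2 * K ^ 2) ^ m * (h * L) ^ m) * V ω
        + (ENNReal.ofReal (((h * L) ^ m)⁻¹ * (16 * h) ^ (2 * m) * (2 * L) ^ (2 * m))
        + ENNReal.ofReal (((h * L) ^ m)⁻¹ * (16 * h) ^ (2 * m) * (c * (N : ℝ)⁻¹))
          * ∑ n ∈ Finset.range (N + 1), E n ω) := by
    intro ω
    refine iSup₂_le fun t ht => ?_
    obtain ⟨h1, h2⟩ := cell_bounds hh ht.1
    -- At t = T the index is N, so N + 1 cells have to be counted.
    have hnN : ⌊t / h⌋₊ ≤ N := by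
      refine Nat.floor_le_of_le ?_
      rw [div_le_iff₀ hh, hNh]
      exact ht.2
    generalize ⌊t / h⌋₊ = n at *
    have hn : n * h ≤ T := h1.trans ht.2
    have hmem : n ∈ Finset.range (N + 1) := by simpa [Nat.lt_succ_iff] using hnN
    have hpow := abs_cellDiff_pow_le (S₀ := S₀) (W := W) hc hh h1 h2.le hn ω m (mul_pos hh hL0)
    have hb1 := hEb' n ω ((n + 1) * h) (by linarith) le_rfl
    have hb2 := hEb' n ω t h1 h2.le
    have hVle : ENNReal.ofReal ((1 + milstein a b S₀ h (realPath W ω) n ^ 2) ^ m) ≤ V ω :=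
      le_iSup₂_of_le n hmem le_rfl
    have hEs : E n ω ≤ ∑ n ∈ Finset.range (N + 1), E n ω :=
      Finset.single_le_sum (f := fun n => E n ω) (fun _ _ => zero_le) hmem
    generalize milstein a b S₀ h (realPath W ω) n = S at *
    generalize realPath W ω ((n + 1) * h) - realPath W ω (n * h) = x at *
    generalize realPath W ω t - realPath W ω (n * h) = z at *
    -- Twice 8h: a sum of two squares is at most twice the larger, so one of the two cell bounds
    -- controls exp y.
    set y := (x ^ 2 + z ^ 2) / (16 * h) with hy
    have hy0 : 0 ≤ y := by positivity
    have hQ : x ^ 2 + z ^ 2 = 16 * h * y := by rw [hy]; field_simp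
    have hyE : ENNReal.ofReal (Real.exp y) ≤ E n ω := by
      rcases le_total (x ^ 2) (z ^ 2) with hxz | hxz
      · refine le_trans (ENNReal.ofReal_le_ofReal (Real.exp_le_exp.2 ?_)) hb2
        rw [hy, div_le_div_iff₀ (by positivity) (by positivity)]
        nlinarith
      · refine le_trans (ENNReal.ofReal_le_ofReal (Real.exp_le_exp.2 ?_)) hb1
        rw [hy, div_le_div_iff₀ (by positivity) (by positivity)]
        nlinarith
    have hyp := pow_le_add_exp (2 * m) hy0 hL0.le
    rw [hexpL] at hyp
    calc ENNReal.ofReal (|cellDiff a b S₀ h W n t ω| ^ m)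
        ≤ ENNReal.ofReal ((2 * K ^ 2) ^ m * (h * L) ^ m * (1 + S ^ 2) ^ m
          + (((h * L) ^ m)⁻¹ * (16 * h) ^ (2 * m) * (2 * L) ^ (2 * m)
            + ((h * L) ^ m)⁻¹ * (16 * h) ^ (2 * m) * (c * (N : ℝ)⁻¹) * Real.exp y)) := by
          refine ENNReal.ofReal_le_ofReal (hpow.trans ?_)
          rw [hQ, mul_pow (16 * h)]
          have : ((h * L) ^ m)⁻¹ * ((16 * h) ^ (2 * m) * y ^ (2 * m))
              ≤ ((h * L) ^ m)⁻¹ * ((16 * h) ^ (2 * m) * ((2 * L) ^ (2 * m) +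
                c * (N : ℝ)⁻¹ * Real.exp y)) := by gcongr
          linarith
      _ = ENNReal.ofReal ((2 * K ^ 2) ^ m * (h * L) ^ m) * ENNReal.ofReal ((1 + S ^ 2) ^ m)
          + (ENNReal.ofReal (((h * L) ^ m)⁻¹ * (16 * h) ^ (2 * m) * (2 * L) ^ (2 * m))
          + ENNReal.ofReal (((h * L) ^ m)⁻¹ * (16 * h) ^ (2 * m) * (c * (N : ℝ)⁻¹))
            * ENNReal.ofReal (Real.exp y)) := by
          rw [ENNReal.ofReal_add (by positivity) (by positivity),
            ENNReal.ofReal_add (by positivity) (by positivity),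
            ENNReal.ofReal_mul (by positivity),
            ENNReal.ofReal_mul (p := ((h * L) ^ m)⁻¹ * (16 * h) ^ (2 * m) * (c * (N : ℝ)⁻¹))
              (by positivity)]
      _ ≤ _ := by
          gcongr
          exact hyE.trans hEs
  calc ∫⁻ ω, (⨆ t ∈ Icc 0 T, ENNReal.ofReal (|cellDiff a b S₀ h W ⌊t / h⌋₊ t ω| ^ m)) ∂P
      ≤ _ := lintegral_mono hpt
    _ ≤ ENNReal.ofReal ((2 * K ^ 2) ^ m * (h * L) ^ m) * ENNReal.ofReal M
        + (ENNReal.ofReal (((h * L) ^ m)⁻¹ * (16 * h) ^ (2 * m) * (2 * L) ^ (2 * m))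
        + ENNReal.ofReal (((h * L) ^ m)⁻¹ * (16 * h) ^ (2 * m) * (c * (N : ℝ)⁻¹))
          * ENNReal.ofReal ((N + 1) * κ)) := by
        rw [lintegral_add_left (hVm.const_mul _), lintegral_add_left measurable_const,
          lintegral_const_mul _ hVm,
          lintegral_const_mul _ (Finset.measurable_fun_sum _ fun n _ => hEm n),
          lintegral_finsetSum _ fun n _ => hEm n, lintegral_const, measure_univ, mul_one]
        gcongr
        · exact hM h N hh.le hhT hhδ hNh.le
        · calc ∑ n ∈ Finset.range (N + 1), ∫⁻ ω, E n ω ∂P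
              ≤ ∑ n ∈ Finset.range (N + 1), ENNReal.ofReal κ := Finset.sum_le_sum fun n _ => hEi n
            _ = ENNReal.ofReal ((N + 1) * κ) := by
              rw [ENNReal.ofReal_mul (by positivity), Finset.sum_const, Finset.card_range,
                nsmul_eq_mul]
              congr 1
              rw [← Nat.cast_succ, ENNReal.ofReal_natCast]
    _ ≤ _ := by
        rw [← ENNReal.ofReal_mul (by positivity), ← ENNReal.ofReal_mul (by positivity),
          ← ENNReal.ofReal_add (by positivity) (by positivity),
          ← ENNReal.ofReal_add (by positivity) (by positivity)]
        refine ENNReal.ofReal_le_ofReal ?_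
        have hhL : 0 < (h * L) ^ m := by positivity
        have t2 : ((h * L) ^ m)⁻¹ * (16 * h) ^ (2 * m) * (2 * L) ^ (2 * m)
            = 32 ^ (2 * m) * (h * L) ^ m := by
          rw [mul_assoc, ← mul_pow (16 * h), show 16 * h * (2 * L) = 32 * (h * L) by ring, mul_pow 32,
            mul_comm 2 m, pow_mul (h * L)]
          field_simp
        have t3 : ((h * L) ^ m)⁻¹ * (16 * h) ^ (2 * m) * (c * (N : ℝ)⁻¹) * ((N + 1) * κ)
            ≤ 16 ^ (2 * m) * c * 2 * κ * (h * L) ^ m := by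
          have hn2 : (N : ℝ)⁻¹ * (N + 1) ≤ 2 := by
            rw [inv_mul_le_iff₀ (by positivity)]; linarith
          -- L ≥ 1 enters here, to replace h by hL.
          have hp : ((h * L) ^ m)⁻¹ * (16 * h) ^ (2 * m) ≤ 16 ^ (2 * m) * (h * L) ^ m := by
            rw [inv_mul_le_iff₀ hhL]
            calc (16 * h) ^ (2 * m) ≤ (16 * (h * L)) ^ (2 * m) := by
                  gcongr
                  exact le_mul_of_one_le_right hh.le hL
              _ = _ := by rw [mul_pow, mul_comm 2 m, pow_mul (h * L)]; ring
          calc ((h * L) ^ m)⁻¹ * (16 * h) ^ (2 * m) * (c * (N : ℝ)⁻¹) * ((N + 1) * κ)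
              = ((h * L) ^ m)⁻¹ * (16 * h) ^ (2 * m) * (c * ((N : ℝ)⁻¹ * (N + 1)) * κ) := by ring
            _ ≤ 16 ^ (2 * m) * (h * L) ^ m * (c * 2 * κ) := by gcongr
            _ = _ := by ring
        rw [t2]
        linarith

end

/-! ### Orthogonality of the cells and the time integral -/

section

variable {Ω : Type*} [mΩ : MeasurableSpace Ω] {P : Measure Ω} {W : ℝ≥0 → Ω → ℝ}
  {a b : ℝ → ℝ → ℝ} {S₀ T K : ℝ}

theorem measurable_uncurry_cellDiff (hm : ∀ t, Measurable (W t))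
    (hcont : ∀ ω, Continuous (W · ω)) (hc : LinearlyBoundedCoefficients a b T K) {h : ℝ}
    (hh : 0 ≤ h) (n : ℕ) :
    Measurable fun p : ℝ × Ω => cellDiff a b S₀ h W n p.1 p.2 := by
  have hS := measurable_milstein (S₀ := S₀) hm hc hh n
  have mb : Measurable fun ω => b (milstein a b S₀ h (realPath W ω) n) (n * h) :=
    (hc.measurable_vol (n * h) (by positivity)).comp hS
  have md : Measurable fun ω => dS b (milstein a b S₀ h (realPath W ω) n) (n * h) :=
    (hc.measurable_dS_vol (n * h) (by positivity)).comp hS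
  have m1 := measurable_realPath hm ((n + 1) * h)
  have m2 := measurable_realPath hm (n * h)
  have m3 : Measurable fun p : ℝ × Ω => realPath W p.2 p.1 :=
    (measurable_uncurry_of_continuous_of_measurable hcont hm).comp
      (f := fun p : ℝ × Ω => (p.1.toNNReal, p.2))
      ((measurable_real_toNNReal.comp measurable_fst).prodMk measurable_snd)
  have l2 {f : Ω → ℝ} (hf : Measurable f) : Measurable fun p : ℝ × Ω => f p.2 :=
    hf.comp measurable_snd
  unfold cellDiff
  exact (((l2 md).mul (l2 mb)).const_mul (1 / 2)).mul
    ((((measurable_fst.sub_const _).div_const h).mul (((l2 m1).sub (l2 m2)).pow_const 2)).sub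
      ((m3.sub (l2 m2)).pow_const 2))

theorem measurable_uncurry_interpolantDiff (hm : ∀ t, Measurable (W t))
    (hcont : ∀ ω, Continuous (W · ω)) (hc : LinearlyBoundedCoefficients a b T K) (hT : 0 < T)
    {N : ℕ} (hN : 0 < N) :
    Measurable fun p : ℝ × Ω => interpolantDiff a b S₀ T W N p.1 p.2 := by
  simp_rw [interpolantDiff_eq_cellDiff hT hN]
  have hh : 0 ≤ T / N := by positivity
  have h1 : Measurable fun q : ℕ × (ℝ × Ω) => cellDiff a b S₀ (T / N) W q.1 q.2.1 q.2.2 :=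
    measurable_from_prod_countable_right fun n =>
      measurable_uncurry_cellDiff hm hcont hc hh n
  exact h1.comp (f := fun p : ℝ × Ω => (⌊p.1 / (T / N)⌋₊, p))
    ((Nat.measurable_floor.comp (measurable_fst.div_const _)).prodMk measurable_id)

theorem measurable_past_cellDiff {Ω : Type*} {W : ℝ≥0 → Ω → ℝ}
    (hc : LinearlyBoundedCoefficients a b T K) {h : ℝ} (hh : 0 ≤ h) {t₀ : ℝ≥0}
    {n : ℕ} {t : ℝ} (hn : (n + 1) * h ≤ t₀) (ht : t ≤ t₀) :
    Measurable[past W t₀] (cellDiff a b S₀ h W n t) := by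
  have hn' : n * h ≤ t₀ := by linarith
  have hS := measurable_past_milstein (W := W) (S₀ := S₀) hc hh n hn'
  have mb := (hc.measurable_vol (n * h) (by positivity)).comp hS
  have md := (hc.measurable_dS_vol (n * h) (by positivity)).comp hS
  have w1 : Measurable[past W t₀] fun ω => W ((n + 1) * h).toNNReal ω :=
    measurable_past (Real.toNNReal_le_iff_le_coe.2 hn)
  have w2 : Measurable[past W t₀] fun ω => W (n * h).toNNReal ω :=
    measurable_past (Real.toNNReal_le_iff_le_coe.2 hn')
  have w3 : Measurable[past W t₀] fun ω => W t.toNNReal ω :=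
    measurable_past (Real.toNNReal_le_iff_le_coe.2 ht)
  exact ((md.mul mb).const_mul (1 / 2)).mul
    ((((w1.sub w2).pow_const 2).const_mul _).sub ((w3.sub w2).pow_const 2))

/-- The differences of the interpolants at times in different cells are orthogonal. -/
theorem integral_cellDiff_mul_cellDiff [IsProbabilityMeasure P] (hW : IsPreBrownianReal W P)
    (hm : ∀ t, Measurable (W t)) (hc : LinearlyBoundedCoefficients a b T K) {h : ℝ} (hh : 0 < h)
    {k n : ℕ} (hkn : k < n) {s t : ℝ} (hs : s ≤ (k + 1) * h) (h1 : n * h ≤ t) :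
    ∫ ω, cellDiff a b S₀ h W k s ω * cellDiff a b S₀ h W n t ω ∂P = 0 := by
  have hn0 : 0 ≤ n * h := by positivity
  have hkn' : (k + 1) * h ≤ n * h := by
    have : (k : ℝ) + 1 ≤ n := by exact_mod_cast hkn
    gcongr
  set t₀ := (n * h).toNNReal with ht₀
  have ht₀c : (t₀ : ℝ) = n * h := Real.coe_toNNReal _ hn0
  -- Everything known at t_n is collected here: the earlier difference and the coefficient of the
  -- later one. The rest is a functional of the increments after t_n.
  have hX : Measurable[past W t₀] fun ω => cellDiff a b S₀ h W k s ω
      * (1 / 2 * (dS b (milstein a b S₀ h (realPath W ω) n) (n * h)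
      * b (milstein a b S₀ h (realPath W ω) n) (n * h))) := by
    have hS := measurable_past_milstein (W := W) (S₀ := S₀) hc hh.le (t₀ := t₀) n ht₀c.ge
    have mb := (hc.measurable_vol (n * h) hn0).comp hS
    have md := (hc.measurable_dS_vol (n * h) hn0).comp hS
    exact (measurable_past_cellDiff hc hh.le (by rwa [ht₀c]) (by rw [ht₀c]; linarith)).mul
      ((md.mul mb).const_mul (1 / 2))
  have hi := indepFun_past hW hX
    (Ψ := fun f => (t - n * h) / h * f h.toNNReal ^ 2 - f (t - n * h).toNNReal ^ 2)
    (by fun_prop)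
  have e1 : t₀ + h.toNNReal = ((n + 1) * h).toNNReal := (toNNReal_succ_mul hh.le n).symm
  have e2 : t₀ + (t - n * h).toNNReal = t.toNNReal := by
    rw [ht₀, ← Real.toNNReal_add hn0 (by linarith), add_sub_cancel]
  simp only [e1, e2] at hi
  have hsq : ∀ r : ℝ, n * h ≤ r →
      Integrable (fun ω => (W r.toNNReal ω - W t₀ ω) ^ 2) P ∧
      ∫ ω, (W r.toNNReal ω - W t₀ ω) ^ 2 ∂P = r - n * h := by
    intro r hr
    have hl := hasLaw_realPath_sub hW hn0 hr
    constructor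
    · have hg := integrable_pow_gaussian (r - n * h).toNNReal 2
      rw [← hl.map_eq] at hg
      exact hg.comp_aemeasurable hl.aemeasurable
    · have := hl.integral_comp (f := fun z : ℝ => z ^ 2) (by fun_prop)
      rw [integral_sq_gaussianReal, Real.coe_toNNReal _ (by linarith)] at this
      exact this
  obtain ⟨i1, v1⟩ := hsq ((n + 1) * h) (by linarith)
  obtain ⟨i2, v2⟩ := hsq t h1
  -- The mean is λh - (t - t_n) = 0, the cancellation behind the third power of h.
  have hΨ : ∫ ω, ((t - n * h) / h * (W ((n + 1) * h).toNNReal ω - W t₀ ω) ^ 2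
      - (W t.toNNReal ω - W t₀ ω) ^ 2) ∂P = 0 := by
    rw [integral_sub (i1.const_mul _) i2, integral_const_mul, v1, v2]
    field_simp
    ring
  have key := hi.integral_fun_mul_eq_mul_integral
    (hX.mono (past_le hm t₀) le_rfl).aestronglyMeasurable
    (((((hm _).sub (hm _)).pow_const 2).const_mul _).sub
      (((hm _).sub (hm _)).pow_const 2)).aestronglyMeasurable
  rw [hΨ, mul_zero] at key
  rw [← key]
  refine integral_congr_ae (ae_of_all _ fun ω => ?_)
  simp only [realPath, cellDiff, ← ht₀]
  ring

theorem integral_interpolantDiff_mul_eq_zero [IsProbabilityMeasure P]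
    (hW : IsPreBrownianReal W P) (hm : ∀ t, Measurable (W t)) (hT : 0 < T)
    (hc : LinearlyBoundedCoefficients a b T K) {N : ℕ} (hN : 0 < N) {s t : ℝ} (hs : 0 ≤ s)
    (ht : 0 ≤ t) (hst : ⌊s / (T / N)⌋₊ ≠ ⌊t / (T / N)⌋₊) :
    ∫ ω, interpolantDiff a b S₀ T W N s ω * interpolantDiff a b S₀ T W N t ω ∂P = 0 := by
  have hh : 0 < T / N := by positivity
  simp_rw [interpolantDiff_eq_cellDiff hT hN]
  rcases lt_or_gt_of_ne hst with h | h
  · exact integral_cellDiff_mul_cellDiff hW hm hc hh h (cell_bounds hh hs).2.le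
      (cell_bounds hh ht).1
  · simp_rw [mul_comm (cellDiff a b S₀ (T / N) W ⌊s / (T / N)⌋₊ s _)]
    exact integral_cellDiff_mul_cellDiff hW hm hc hh h (cell_bounds hh ht).2.le
      (cell_bounds hh hs).1

/-- The time integral of the difference of the interpolants along almost every path, and its second
moment. -/
theorem interpolantDiff_timeIntegral [IsProbabilityMeasure P] (hW : IsPreBrownianReal W P)
    (hm : ∀ t, Measurable (W t)) (hcont : ∀ ω, Continuous (W · ω)) (hT : 0 < T)
    (hc : LinearlyBoundedCoefficients a b T K) (S₀ : ℝ) :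
    (∀ N : ℕ, 0 < N → ∀ᵐ ω ∂P, IntervalIntegrable
      (fun t => interpolantDiff a b S₀ T W N t ω) volume 0 T) ∧
    ∃ C : ℝ, 0 ≤ C ∧ ∀ N : ℕ, 0 < N →
      ∫⁻ ω, ENNReal.ofReal ((∫ t in (0 : ℝ)..T, interpolantDiff a b S₀ T W N t ω) ^ 2) ∂P
        ≤ ENNReal.ofReal (C * (T / N) ^ 3) := by
  obtain ⟨C, hC0, hC⟩ := interpolantDiff_moment_le hW hm hT hc S₀ 2
  set ν := (volume : Measure ℝ).restrict (Ioc 0 T) with hν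
  have hνT : ν univ = ENNReal.ofReal T := by simp [hν]
  have hνmem : ∀ᵐ t ∂ν, t ∈ Ioc 0 T := ae_restrict_mem measurableSet_Ioc
  have hprod : ∀ N : ℕ, 0 < N → ∀ s ∈ Icc 0 T, ∀ t ∈ Icc 0 T,
      ∫⁻ ω, ‖interpolantDiff a b S₀ T W N s ω * interpolantDiff a b S₀ T W N t ω‖ₑ ∂P
        ≤ ENNReal.ofReal (C * (T / N) ^ 2) := by
    intro N hN s hs t ht
    have hD := measurable_uncurry_interpolantDiff (S₀ := S₀) hm hcont hc hT hN
    have hDs : ∀ r, Measurable (interpolantDiff a b S₀ T W N r) := fun r =>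
      hD.comp (measurable_const.prodMk measurable_id)
    have m1 := hDs s
    have m2 := hDs t
    calc ∫⁻ ω, ‖interpolantDiff a b S₀ T W N s ω * interpolantDiff a b S₀ T W N t ω‖ₑ ∂P
        ≤ ∫⁻ ω, (ENNReal.ofReal (1 / 2) * ENNReal.ofReal (|interpolantDiff a b S₀ T W N s ω| ^ 2)
          + ENNReal.ofReal (1 / 2)
            * ENNReal.ofReal (|interpolantDiff a b S₀ T W N t ω| ^ 2)) ∂P := by
          refine lintegral_mono fun ω => ?_
          rw [Real.enorm_eq_ofReal_abs, ← ENNReal.ofReal_mul (by norm_num),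
            ← ENNReal.ofReal_mul (by norm_num),
            ← ENNReal.ofReal_add (by positivity) (by positivity), abs_mul]
          refine ENNReal.ofReal_le_ofReal ?_
          nlinarith [sq_nonneg (|interpolantDiff a b S₀ T W N s ω|
            - |interpolantDiff a b S₀ T W N t ω|)]
      _ ≤ ENNReal.ofReal (1 / 2) * ENNReal.ofReal (C * (T / N) ^ 2)
          + ENNReal.ofReal (1 / 2) * ENNReal.ofReal (C * (T / N) ^ 2) := by
          rw [lintegral_add_left (by fun_prop), lintegral_const_mul _ (by fun_prop),
            lintegral_const_mul _ (by fun_prop)]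
          gcongr
          · exact hC N hN s hs
          · exact hC N hN t ht
      _ = _ := by
          rw [← add_mul, ← ENNReal.ofReal_add (by norm_num) (by norm_num)]
          norm_num
  -- Joint integrability in both times and ω justifies the exchanges of integrals below.
  have hfin : ∀ N : ℕ, 0 < N → Integrable (fun q : (ℝ × ℝ) × Ω =>
      interpolantDiff a b S₀ T W N q.1.1 q.2 * interpolantDiff a b S₀ T W N q.1.2 q.2)
      ((ν.prod ν).prod P) := by
    intro N hN
    have hD := measurable_uncurry_interpolantDiff (S₀ := S₀) hm hcont hc hT hN
    have hDD : Measurable fun q : (ℝ × ℝ) × Ω =>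
      interpolantDiff a b S₀ T W N q.1.1 q.2 * interpolantDiff a b S₀ T W N q.1.2 q.2 :=
      (hD.comp (f := fun q : (ℝ × ℝ) × Ω => (q.1.1, q.2)) (by fun_prop)).mul
        (hD.comp (f := fun q : (ℝ × ℝ) × Ω => (q.1.2, q.2)) (by fun_prop))
    refine ⟨hDD.aestronglyMeasurable, ?_⟩
    rw [hasFiniteIntegral_iff_enorm, lintegral_prod _ hDD.enorm.aemeasurable,
      lintegral_prod _ hDD.enorm.lintegral_prod_right'.aemeasurable]
    have : ∫⁻ s, ∫⁻ t, ∫⁻ ω, ‖interpolantDiff a b S₀ T W N s ω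
        * interpolantDiff a b S₀ T W N t ω‖ₑ ∂P ∂ν ∂ν
        ≤ ∫⁻ _, ∫⁻ _, ENNReal.ofReal (C * (T / N) ^ 2) ∂ν ∂ν := by
      refine lintegral_mono_ae ?_
      filter_upwards [hνmem] with s hs
      refine lintegral_mono_ae ?_
      filter_upwards [hνmem] with t ht
      exact hprod N hN s (Ioc_subset_Icc_self hs) t (Ioc_subset_Icc_self ht)
    refine this.trans_lt ?_
    simp only [lintegral_const, hνT]
    finiteness
  constructor
  · intro N hN
    have hD := measurable_uncurry_interpolantDiff (S₀ := S₀) hm hcont hc hT hN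
    have hsq : ∫⁻ ω, ∫⁻ t, ENNReal.ofReal (|interpolantDiff a b S₀ T W N t ω| ^ 2) ∂ν ∂P < ∞ := by
      have hswap := lintegral_lintegral_swap (μ := P) (ν := ν)
        (f := fun ω t => ENNReal.ofReal (|interpolantDiff a b S₀ T W N t ω| ^ 2))
        (((hD.comp measurable_swap).abs.pow_const 2).ennreal_ofReal.aemeasurable)
      rw [hswap]
      calc ∫⁻ t, ∫⁻ ω, ENNReal.ofReal (|interpolantDiff a b S₀ T W N t ω| ^ 2) ∂P ∂ν
          ≤ ∫⁻ _, ENNReal.ofReal (C * (T / N) ^ 2) ∂ν := by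
            refine lintegral_mono_ae ?_
            filter_upwards [hνmem] with t ht
            exact hC N hN t (Ioc_subset_Icc_self ht)
        _ < ∞ := by
            rw [lintegral_const, hνT]
            finiteness
    have hae := ae_lt_top' (((hD.comp measurable_swap).abs.pow_const
      2).ennreal_ofReal.lintegral_prod_right').aemeasurable hsq.ne
    filter_upwards [hae] with ω hω
    rw [intervalIntegrable_iff_integrableOn_Ioc_of_le hT.le]
    have hDω : Measurable fun t => interpolantDiff a b S₀ T W N t ω :=
      hD.comp (measurable_id.prodMk measurable_const)
    have hL2 : MemLp (fun t => interpolantDiff a b S₀ T W N t ω) 2 ν := by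
      refine (memLp_two_iff_integrable_sq hDω.aestronglyMeasurable).2
        ⟨(hDω.pow_const 2).aestronglyMeasurable, ?_⟩
      rw [hasFiniteIntegral_iff_ofReal (ae_of_all _ fun t => sq_nonneg _)]
      simpa only [Function.comp_apply, Prod.swap_prod_mk, sq_abs] using hω
    exact hL2.integrable (by norm_num)
  -- For fixed s only times t in the same cell contribute: C h² times the cell length h, integrated
  -- over s in (0, T].
  · refine ⟨C * T, by positivity, fun N hN => ?_⟩
    set D := interpolantDiff a b S₀ T W N with hDdef
    have hh : 0 < T / N := by positivity
    have hint := hfin N hN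
    have hsq : ∀ ω, (∫ t in (0 : ℝ)..T, D t ω) ^ 2 = ∫ p, D p.1 ω * D p.2 ω ∂(ν.prod ν) := by
      intro ω
      rw [integral_prod_mul (fun t => D t ω) (fun t => D t ω), ← sq,
        intervalIntegral.integral_of_le hT.le]
    have hsqi : Integrable (fun ω => (∫ t in (0 : ℝ)..T, D t ω) ^ 2) P := by
      simp_rw [hsq]
      exact hint.integral_prod_right
    rw [← ofReal_integral_eq_lintegral_ofReal hsqi (ae_of_all _ fun ω => sq_nonneg _)]
    have hval : ∫ ω, (∫ t in (0 : ℝ)..T, D t ω) ^ 2 ∂P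
        = ∫ p, ∫ ω, D p.1 ω * D p.2 ω ∂P ∂(ν.prod ν) := by
      simp_rw [hsq]
      exact (integral_integral_swap
        (f := fun (p : ℝ × ℝ) ω => D p.1 ω * D p.2 ω) hint).symm
    have hpoint : ∀ s ∈ Icc 0 T, ∀ t ∈ Icc 0 T, ‖∫ ω, D s ω * D t ω ∂P‖ₑ
        ≤ (Ico (⌊s / (T / N)⌋₊ * (T / N)) ((⌊s / (T / N)⌋₊ + 1) * (T / N))).indicator
          (fun _ => ENNReal.ofReal (C * (T / N) ^ 2)) t := by
      intro s hs t ht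
      by_cases hst : ⌊s / (T / N)⌋₊ = ⌊t / (T / N)⌋₊
      · rw [indicator_of_mem]
        · exact (enorm_integral_le_lintegral_enorm _).trans (hprod N hN s hs t ht)
        · rw [hst]
          exact cell_bounds hh ht.1
      · rw [hDdef, integral_interpolantDiff_mul_eq_zero hW hm hT hc hN hs.1 ht.1 hst]
        simp
    calc ENNReal.ofReal (∫ ω, (∫ t in (0 : ℝ)..T, D t ω) ^ 2 ∂P)
        ≤ ‖∫ p, ∫ ω, D p.1 ω * D p.2 ω ∂P ∂(ν.prod ν)‖ₑ := by
          rw [hval, Real.enorm_eq_ofReal_abs]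
          exact ENNReal.ofReal_le_ofReal (le_abs_self _)
      _ ≤ ∫⁻ p, ‖∫ ω, D p.1 ω * D p.2 ω ∂P‖ₑ ∂(ν.prod ν) :=
          enorm_integral_le_lintegral_enorm _
      _ = ∫⁻ s, ∫⁻ t, ‖∫ ω, D s ω * D t ω ∂P‖ₑ ∂ν ∂ν :=
          lintegral_prod _ hint.integral_prod_left.aestronglyMeasurable.enorm
      _ ≤ ∫⁻ _, ENNReal.ofReal (C * (T / N) ^ 2) * ENNReal.ofReal (T / N) ∂ν := by
          refine lintegral_mono_ae ?_
          filter_upwards [hνmem] with s hs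
          calc ∫⁻ t, ‖∫ ω, D s ω * D t ω ∂P‖ₑ ∂ν
              ≤ ∫⁻ t, (Ico (⌊s / (T / N)⌋₊ * (T / N))
                  ((⌊s / (T / N)⌋₊ + 1) * (T / N))).indicator
                  (fun _ => ENNReal.ofReal (C * (T / N) ^ 2)) t ∂ν := by
                refine lintegral_mono_ae ?_
                filter_upwards [hνmem] with t ht
                exact hpoint s (Ioc_subset_Icc_self hs) t (Ioc_subset_Icc_self ht)
            _ = ENNReal.ofReal (C * (T / N) ^ 2) * ν (Ico (⌊s / (T / N)⌋₊ * (T / N))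
                  ((⌊s / (T / N)⌋₊ + 1) * (T / N))) :=
                lintegral_indicator_const measurableSet_Ico _
            _ ≤ ENNReal.ofReal (C * (T / N) ^ 2) * volume (Ico (⌊s / (T / N)⌋₊ * (T / N))
                  ((⌊s / (T / N)⌋₊ + 1) * (T / N))) := by
                gcongr
                exact Measure.restrict_le_self
            _ = _ := by
                rw [Real.volume_Ico]
                congr 2
                ring
      _ = _ := by
          rw [lintegral_const, hνT, ← ENNReal.ofReal_mul (by positivity),
            ← ENNReal.ofReal_mul (by positivity)]
          congr 1
          ring

end

/-- The logarithm of the number of timesteps is eventually comparable to that of the timestep. -/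
theorem eventually_mul_log_le {T : ℝ} (hT : 0 < T) :
    ∀ᶠ N : ℕ in atTop, 0 ≤ T / N * Real.log N ∧
      T / N * Real.log N ≤ 2 * |T / N * Real.log (T / N)| := by
  have hlog : Tendsto (fun N : ℕ => Real.log N) atTop atTop :=
    Real.tendsto_log_atTop.comp tendsto_natCast_atTop_atTop
  -- Since |log T| ≤ ½ log N, also log N - log T ≥ ½ log N.
  filter_upwards [eventually_gt_atTop 0, hlog.eventually_ge_atTop (2 * |Real.log T|)] with N hN hL
  have hN' : (0 : ℝ) < N := by exact_mod_cast hN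
  have hh : 0 < T / N := by positivity
  have h0 := abs_nonneg (Real.log T)
  refine ⟨mul_nonneg hh.le (by linarith), ?_⟩
  rw [abs_mul, abs_of_pos hh, mul_left_comm]
  gcongr
  rw [Real.log_div hT.ne' hN'.ne', abs_sub_comm]
  linarith [le_abs_self (Real.log N - Real.log T), le_abs_self (Real.log T)]

end MilsteinMLMC

/-! ### Transfer to the given Brownian motion -/

theorem theorem4 {Ω : Type*} [MeasurableSpace Ω] (P : Measure Ω) [IsProbabilityMeasure P]
    (W : ℝ≥0 → Ω → ℝ) (hW : IsBrownianReal W P)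
    (a b : ℝ → ℝ → ℝ) (S₀ T : ℝ) (hT : 0 < T)
    (hab : MilsteinMLMC.Assumptions a b T) :
    (∀ m : ℕ, 0 < m →
      (∃ C : ℝ≥0, ∀ᶠ N : ℕ in atTop,
        (∫⁻ ω, (⨆ t ∈ Icc 0 T,
            ENNReal.ofReal (|MilsteinMLMC.interpolantDiff a b S₀ T W N t ω| ^ m)) ∂P)
          ≤ C * ENNReal.ofReal (|T / N * Real.log (T / N)| ^ m)) ∧
      (∃ C : ℝ≥0, ∀ᶠ N : ℕ in atTop,
        (⨆ t ∈ Icc 0 T,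
            ∫⁻ ω, ENNReal.ofReal (|MilsteinMLMC.interpolantDiff a b S₀ T W N t ω| ^ m) ∂P)
          ≤ C * ENNReal.ofReal ((T / N) ^ m))) ∧
    (∀ N : ℕ, 0 < N → ∀ᵐ ω ∂P, IntervalIntegrable
      (fun t => MilsteinMLMC.interpolantDiff a b S₀ T W N t ω) volume 0 T) ∧
    (∃ C : ℝ≥0, ∀ᶠ N : ℕ in atTop,
      (∫⁻ ω, ENNReal.ofReal
          ((∫ t in (0 : ℝ)..T, MilsteinMLMC.interpolantDiff a b S₀ T W N t ω) ^ 2) ∂P)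
        ≤ C * ENNReal.ofReal ((T / N) ^ 3)) := by
  obtain ⟨K, hc⟩ := hab.exists_linearlyBounded
  -- The paths of `W` and `B` agree at all times outside one null set, so suprema over t and time
  -- integrals transfer as well.
  obtain ⟨B, hm, hcont, hWB⟩ :=
    MilsteinMLMC.exists_continuous_measurable_modification hW.aemeasurable hW.cont
  have hB : IsPreBrownianReal B P :=
    hW.toIsPreBrownianReal.congr fun t => hWB.mono fun ω h => h t
  have hD : ∀ᵐ ω ∂P, ∀ N t, MilsteinMLMC.interpolantDiff a b S₀ T W N t ω
      = MilsteinMLMC.interpolantDiff a b S₀ T B N t ω := by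
    filter_upwards [hWB] with ω hω N t
    simp only [MilsteinMLMC.interpolantDiff, hω]
  refine ⟨fun m _ => ⟨?_, ?_⟩, ?_, ?_⟩
  · obtain ⟨C, hC0, hC⟩ := MilsteinMLMC.interpolantDiff_iSup_le hB hm hcont hT hc S₀ m
    -- The factor 2^m is the price of replacing log N by |log h|.
    refine ⟨(C * 2 ^ m).toNNReal, ?_⟩
    filter_upwards [hC, MilsteinMLMC.eventually_mul_log_le hT] with N hN hlog
    have heq : ∫⁻ ω, (⨆ t ∈ Icc 0 T,
          ENNReal.ofReal (|MilsteinMLMC.interpolantDiff a b S₀ T W N t ω| ^ m)) ∂P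
        = ∫⁻ ω, (⨆ t ∈ Icc 0 T,
          ENNReal.ofReal (|MilsteinMLMC.interpolantDiff a b S₀ T B N t ω| ^ m)) ∂P :=
      lintegral_congr_ae (hD.mono fun ω hω => by simp only [hω])
    rw [heq, ← ENNReal.ofReal, ← ENNReal.ofReal_mul (by positivity)]
    refine hN.trans (ENNReal.ofReal_le_ofReal ?_)
    rw [mul_assoc, ← mul_pow]
    exact mul_le_mul_of_nonneg_left (pow_le_pow_left₀ hlog.1 hlog.2 m) hC0
  · obtain ⟨C, hC0, hC⟩ := MilsteinMLMC.interpolantDiff_moment_le hB hm hT hc S₀ m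
    refine ⟨C.toNNReal, ?_⟩
    filter_upwards [eventually_gt_atTop 0] with N hN
    rw [← ENNReal.ofReal, ← ENNReal.ofReal_mul hC0]
    refine iSup₂_le fun t ht => le_trans (le_of_eq ?_) (hC N hN t ht)
    exact lintegral_congr_ae (hD.mono fun ω hω => by simp only [hω])
  · intro N hN
    filter_upwards [hD, (MilsteinMLMC.interpolantDiff_timeIntegral hB hm hcont hT hc S₀).1 N hN]
      with ω hω hi
    simpa only [hω] using hi
  · obtain ⟨C, hC0, hC⟩ := (MilsteinMLMC.interpolantDiff_timeIntegral hB hm hcont hT hc S₀).2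
    refine ⟨C.toNNReal, ?_⟩
    filter_upwards [eventually_gt_atTop 0] with N hN
    rw [← ENNReal.ofReal, ← ENNReal.ofReal_mul hC0]
    refine le_trans (le_of_eq ?_) (hC N hN)
    exact lintegral_congr_ae (hD.mono fun ω hω => by simp only [hω])
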